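/- There is an absolute constant $C\ge 1$ with the following property. Let $A$ be a finite non-empty subset of an abelian group $\mathbf G$, and for $x\in\mathbf G$ let $(A\circ A)(x)=|\{y\in A: y+x\in A\}|$. Let $\mathsf E(A)=|\{(a_1,a_2,b_1,b_2)\in A^4: a_1+b_1=a_2+b_2\}|$ be the additive energy of $A$ and, for real $s>0$, let $\mathsf E_s(A)=\sum_{x\in\mathbf G}(A\circ A)(x)^s$. Let $\varepsilon\in(0,1]$ and suppose that $$\mathsf E(A)=\frac{|A|^3}{K}\qquad\text{and}\qquad \mathsf E_{3+\varepsilon}(A)=\frac{M|A|^{4+\varepsilon}}{K^{2+\varepsilon}}.$$ Then there exists $A'\subseteq A$ such that $$|A'|\ \ge\ C^{-1/\varepsilon}\,M^{-\frac{3+6\varepsilon}{\varepsilon(1+\varepsilon)}}\,|A|$$ and, for all integers $n,m\ge 0$ (the same $A'$ serving for all $n,m$), $$|nA'-mA'|\ \le\ C^{(n+m)/\varepsilon}\,M^{6(n+m)\frac{3+4\varepsilon}{\varepsilon(1+\varepsilon)}}\,K\,|A'| ,$$ where $nA'=A'+\dots+A'$ ($n$ summands, $0A'=\{0\}$). -/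

import Mathlib

open scoped Pointwise

/-- `(A ∘ A)(x) = ∑_y A(y) A(y + x)`: the number of representations of `x` as a difference of two
elements of `A`. -/
def diffRep {G : Type*} [AddCommGroup G] [DecidableEq G] (A : Finset G) (x : G) : ℕ :=
  (A.filter (fun y => y + x ∈ A)).card

/-- Only `x ∈ A - A` has a representation. -/
theorem diffRep_eq_zero {G : Type*} [AddCommGroup G] [DecidableEq G] {A : Finset G} {x : G}
    (hx : x ∉ A - A) : diffRep A x = 0 := by
  rw [diffRep, Finset.card_eq_zero, Finset.filter_eq_empty_iff]
  intro y hy hyx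
  exact hx (Finset.mem_sub.2 ⟨y + x, hyx, y, hy, by abel⟩)

/-- The higher energy `E_s(A) = ∑_x (A ∘ A)(x) ^ s` of real order `s > 0`. The terms with
`x ∉ A - A` vanish, so the sum is taken over the finite set `A - A`. -/
noncomputable def higherEnergy {G : Type*} [AddCommGroup G] [DecidableEq G]
    (s : ℝ) (A : Finset G) : ℝ :=
  ∑ x ∈ A - A, (diffRep A x : ℝ) ^ s

/-- The sum over `A - A` is the sum over the whole group. -/
theorem higherEnergy_eq_finsum {G : Type*} [AddCommGroup G] [DecidableEq G]
    {s : ℝ} (hs : 0 < s) (A : Finset G) :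
    higherEnergy s A = ∑ᶠ x : G, (diffRep A x : ℝ) ^ s := by
  rw [higherEnergy, finsum_eq_sum_of_support_subset]
  intro x hx
  by_contra h
  apply hx
  have h0 : diffRep A x = 0 := diffRep_eq_zero (fun hm => h (Finset.mem_coe.2 hm))
  simp [h0, Real.zero_rpow hs.ne']

/-- The `n`-fold sumset `nA = A + ⋯ + A` (`n` summands), with `0A = {0}`. It is not the dilate
`{n a : a ∈ A}`. -/
def iterSumset {G : Type*} [AddCommGroup G] [DecidableEq G] : ℕ → Finset G → Finset G
  | 0, _ => {0}
  | n + 1, A => iterSumset n A + A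

/-! ### Second and third moments of the difference representation function -/

section DiffRep

variable {G : Type*} [AddCommGroup G] [DecidableEq G]

/-! Write `r` for `diffRep A`, `a = |A|`, `ρ = a / K` and `μ = M ^ (1 / (1 + ε))`. The hypotheses
say that the second moment of `r` is `a²ρ` and the `(3 + ε)`-th is `M a²ρ^(2 + ε)`; interpolation
bounds the third by `2μa²ρ²`.

The matrix `r(x - y)` on `A × A` is a Gram matrix with entry sum `E(A)`, so the trace of its cube is
at least `(E(A) / a)³`. That trace counts weighted triangles in `A`; Cauchy–Schwarz in the
differences `(s, t)` costs a factor `E₃(A)` and gives `∑ r(s)² r(t)² r(s - t)² ≥ a⁴ρ⁴ / (2μ)`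
(`addEnergy_pow_six_le`).

The moments confine a positive proportion of this sum to triples of comparable height. Pigeonholing
the heights yields level sets `P₁, P₂, P₃` of `r` with nearly as many solutions of `s - t ∈ P₃` as
the third moment permits. Balog–Szemerédi–Gowers then finds `P ⊆ P₁` of small doubling. As the
elements of `P` are popular differences, some translate of `P` meets `A` in a large set `A'`, and
Plünnecke–Ruzsa for `P` bounds `nA' - mA'`.

The levels have ratio `2ν` with `ν ^ 6 = μ`, instead of `2`. Then `O(1/ε)` levels suffice, uniformly
in `M`, so no logarithm of `M` is lost; the price is one factor `64μ`. -/

theorem diffRep_neg (A : Finset G) (x : G) : diffRep A (-x) = diffRep A x := by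
  unfold diffRep
  refine Finset.card_nbij' (fun y => y + -x) (fun y => y + x) ?_ ?_ ?_ ?_ <;>
    simp +contextual [Set.MapsTo, Set.LeftInvOn]

theorem diffRep_sub_comm (A : Finset G) (x y : G) : diffRep A (x - y) = diffRep A (y - x) := by
  rw [← neg_sub, diffRep_neg]

theorem diffRep_eq_sum (A : Finset G) (x : G) :
    (diffRep A x : ℝ) = ∑ y ∈ A, if y + x ∈ A then (1 : ℝ) else 0 := by
  simp [diffRep]

/-- Summing over the differences `s` with `x - s ∈ A` amounts to summing over `A`. -/
theorem sum_sub_indicator (A : Finset G) {x : G} (hx : x ∈ A) (F : G → ℝ) :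
    ∑ s ∈ A - A, (if x - s ∈ A then F s else 0) = ∑ y ∈ A, F (x - y) := by
  rw [← Finset.sum_filter]
  refine Finset.sum_nbij' (fun s => x - s) (fun y => x - y) ?_ ?_ ?_ ?_ ?_
  · intro s hs
    exact (Finset.mem_filter.1 hs).2
  · intro y hy
    simp [hy, Finset.sub_mem_sub hx hy]
  · intro s _
    simp
  · intro s _
    simp
  · intro s _
    simp

theorem sum_sub_add_indicator (A : Finset G) {y : G} (hy : y ∈ A) (F : G → ℝ) :
    ∑ s ∈ A - A, (if y + s ∈ A then F s else 0) = ∑ x ∈ A, F (x - y) := by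
  rw [← Finset.sum_filter]
  refine Finset.sum_nbij' (fun s => y + s) (fun x => x - y) ?_ ?_ ?_ ?_ ?_
  · intro s hs
    exact (Finset.mem_filter.1 hs).2
  · intro x hx
    simp [hx, Finset.sub_mem_sub hx hy]
  · intro s _
    simp
  · intro s _
    simp
  · intro s _
    simp

theorem sum_diffRep_mul (A : Finset G) (F : G → ℝ) :
    ∑ s ∈ A - A, (diffRep A s : ℝ) * F s = ∑ x ∈ A, ∑ y ∈ A, F (x - y) := by
  simp_rw [diffRep_eq_sum, Finset.sum_mul, ite_mul, one_mul, zero_mul]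
  rw [Finset.sum_comm]
  rw [Finset.sum_congr rfl fun y hy => sum_sub_add_indicator A hy F]
  exact Finset.sum_comm

theorem sum_diffRep (A : Finset G) : ∑ s ∈ A - A, (diffRep A s : ℝ) = (A.card : ℝ) ^ 2 := by
  have := sum_diffRep_mul A fun _ => 1
  simp only [mul_one] at this
  rw [this]
  simp [sq]

theorem sum_diffRep_sq (A : Finset G) :
    ∑ s ∈ A - A, (diffRep A s : ℝ) ^ 2 = (Finset.addEnergy A A : ℝ) := by
  simp_rw [sq]
  rw [sum_diffRep_mul, Finset.addEnergy]
  simp_rw [diffRep_eq_sum]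
  rw [Finset.card_filter]
  push_cast
  simp_rw [Finset.sum_product]
  refine Finset.sum_congr rfl fun x _ => Finset.sum_congr rfl fun y hy => ?_
  refine Finset.sum_congr rfl fun z hz => ?_
  have key : ∀ w : G, x + z = y + w ↔ w = z + (x - y) := by
    intro w
    constructor <;> intro h
    · rw [← add_sub_assoc, add_comm z, h, add_sub_cancel_left]
    · rw [h]; abel
  simp [key]

/-- Expanding the square counts `(x, x', s, t)` with `x - s, x' - s, x - t, x' - t ∈ A`. For fixed
`x, x' ∈ A` the choices of `s` and `t` are independent, with `r(x - x')` possibilities each, and `∑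
r(x - x')²` is the third moment. -/
theorem sum_common_translates_sq (A : Finset G) :
    ∑ s ∈ A - A, ∑ t ∈ A - A,
      (∑ x ∈ A, if x - s ∈ A then (if x - t ∈ A then (1 : ℝ) else 0) else 0) ^ 2 =
    ∑ d ∈ A - A, (diffRep A d : ℝ) ^ 3 := by
  have h1 : ∀ x ∈ A, ∀ x' ∈ A, ∑ s ∈ A - A,
      (if x - s ∈ A then (if x' - s ∈ A then (1 : ℝ) else 0) else 0) = diffRep A (x - x') := by
    intro x hx x' _
    rw [sum_sub_indicator A hx, diffRep_sub_comm, diffRep_eq_sum]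
    refine Finset.sum_congr rfl fun y _ => ?_
    rw [show x' - (x - y) = y + (x' - x) by abel]
  have h3 : ∑ d ∈ A - A, (diffRep A d : ℝ) ^ 3 =
      ∑ x ∈ A, ∑ x' ∈ A, (diffRep A (x - x') : ℝ) ^ 2 := by
    rw [← sum_diffRep_mul A fun d => (diffRep A d : ℝ) ^ 2]
    exact Finset.sum_congr rfl fun d _ => by ring
  rw [h3]
  have h4 : ∀ x ∈ A, ∀ x' ∈ A, (diffRep A (x - x') : ℝ) ^ 2 = ∑ s ∈ A - A, ∑ t ∈ A - A,
      (if x - s ∈ A then (if x - t ∈ A then (1 : ℝ) else 0) else 0) *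
      (if x' - s ∈ A then (if x' - t ∈ A then (1 : ℝ) else 0) else 0) := by
    intro x hx x' hx'
    rw [← h1 x hx x' hx', sq, Finset.sum_mul_sum]
    refine Finset.sum_congr rfl fun s _ => Finset.sum_congr rfl fun t _ => ?_
    by_cases a : x - s ∈ A <;> by_cases b : x' - s ∈ A <;> by_cases c : x - t ∈ A <;>
      by_cases d : x' - t ∈ A <;> simp [a, b, c, d]
  rw [Finset.sum_congr rfl fun x hx => Finset.sum_congr rfl fun x' hx' => h4 x hx x' hx']
  simp_rw [sq, Finset.sum_mul_sum]
  symm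
  calc _ = ∑ x ∈ A, ∑ s ∈ A - A, ∑ x' ∈ A, ∑ t ∈ A - A,
      (if x - s ∈ A then (if x - t ∈ A then (1 : ℝ) else 0) else 0) *
      (if x' - s ∈ A then (if x' - t ∈ A then (1 : ℝ) else 0) else 0) :=
        Finset.sum_congr rfl fun x _ => Finset.sum_comm
    _ = _ := by
        rw [Finset.sum_comm]
        refine Finset.sum_congr rfl fun s _ => ?_
        rw [Finset.sum_congr rfl fun x _ => Finset.sum_comm, Finset.sum_comm]

theorem sum_triangle_eq (A : Finset G) (F : G → G → ℝ) :
    ∑ x ∈ A, ∑ y ∈ A, ∑ z ∈ A, F (x - y) (x - z) =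
    ∑ s ∈ A - A, ∑ t ∈ A - A,
      (∑ x ∈ A, if x - s ∈ A then (if x - t ∈ A then (1 : ℝ) else 0) else 0) * F s t := by
  have h : ∀ x ∈ A, ∑ y ∈ A, ∑ z ∈ A, F (x - y) (x - z) = ∑ s ∈ A - A, ∑ t ∈ A - A,
      (if x - s ∈ A then (if x - t ∈ A then (1 : ℝ) else 0) else 0) * F s t := by
    intro x hx
    rw [← sum_sub_indicator A hx fun s => ∑ z ∈ A, F s (x - z)]
    refine Finset.sum_congr rfl fun s _ => ?_
    rw [← sum_sub_indicator A hx fun t => F s t]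
    split_ifs with h
    · simp [ite_mul]
    · simp
  rw [Finset.sum_congr rfl h, Finset.sum_comm]
  refine Finset.sum_congr rfl fun s _ => ?_
  rw [Finset.sum_comm]
  exact Finset.sum_congr rfl fun t _ => by rw [Finset.sum_mul]

/-- Group the triangles by `(s, t) = (x - y, x - z)` and apply Cauchy–Schwarz; the squared
multiplicities sum to the third moment. -/
theorem sq_sum_triangle_le (A : Finset G) (F : G → G → ℝ) :
    (∑ x ∈ A, ∑ y ∈ A, ∑ z ∈ A, F (x - y) (x - z)) ^ 2 ≤
      (∑ d ∈ A - A, (diffRep A d : ℝ) ^ 3) * ∑ s ∈ A - A, ∑ t ∈ A - A, F s t ^ 2 := by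
  rw [sum_triangle_eq, ← sum_common_translates_sq]
  simp_rw [← Finset.sum_product']
  exact Finset.sum_mul_sq_le_sq_mul_sq _ _ _

end DiffRep

/-! ### Spectral lower bound for the triangle sum -/

/-- For a Gram matrix `T` with rows indexed by `X`, the third moment of the spectrum is at least the
cube of the mean row sum. -/
theorem cube_sum_gram_le {α β : Type*} (X : Finset α) (U : Finset β) (B : α → β → ℝ)
    (T : α → α → ℝ) (hT : ∀ x ∈ X, ∀ y ∈ X, T x y = ∑ u ∈ U, B x u * B y u) :
    (∑ x ∈ X, ∑ y ∈ X, T x y) ^ 3 ≤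
      (X.card : ℝ) ^ 3 * ∑ x ∈ X, ∑ y ∈ X, ∑ z ∈ X, T x y * T x z * T y z := by
  set E := ∑ x ∈ X, ∑ y ∈ X, T x y with hE
  set V := ∑ x ∈ X, ∑ y ∈ X, ∑ z ∈ X, T x y * T x z * T y z with hV
  -- With `T = BBᵀ`, these are `h = Bᵀ1`, `g = T1`, `k = Bᵀg`. The chain is `(1ᵀT1)² ≤ |X| 1ᵀT²1`,
  -- `(1ᵀT²1)² ≤ (1ᵀT1)(1ᵀT³1)` and `1ᵀT³1 ≤ |X| tr T³`, which needs no eigenvalues.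
  set h : β → ℝ := fun u => ∑ x ∈ X, B x u with hh
  set g : α → ℝ := fun x => ∑ y ∈ X, T x y with hg
  set k : β → ℝ := fun u => ∑ x ∈ X, B x u * g x with hk
  have hsymm : ∀ x ∈ X, ∀ y ∈ X, T x y = T y x := fun x hx y hy => by
    rw [hT x hx y hy, hT y hy x hx]
    exact Finset.sum_congr rfl fun _ _ => mul_comm _ _
  have hg' : ∀ x ∈ X, g x = ∑ u ∈ U, B x u * h u := fun x hx => by
    simp only [hg, hh]
    rw [Finset.sum_congr rfl fun y hy => hT x hx y hy, Finset.sum_comm]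
    exact Finset.sum_congr rfl fun u _ => by rw [Finset.mul_sum]
  have hE1 : E = ∑ u ∈ U, h u ^ 2 := by
    rw [hE, Finset.sum_congr rfl hg', Finset.sum_comm]
    exact Finset.sum_congr rfl fun u _ => by rw [← Finset.sum_mul, sq]
  have hE0 : 0 ≤ E := by rw [hE1]; positivity
  have hE2 : E ^ 2 ≤ X.card * ∑ x ∈ X, g x ^ 2 := by
    simpa [hE, hg] using sq_sum_le_card_mul_sum_sq (s := X) (f := g)
  have hG : ∑ x ∈ X, g x ^ 2 = ∑ u ∈ U, h u * k u := by
    have : ∀ x ∈ X, g x ^ 2 = ∑ u ∈ U, B x u * h u * g x := fun x hx => by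
      rw [sq, ← Finset.sum_mul, ← hg' x hx]
    rw [Finset.sum_congr rfl this, Finset.sum_comm]
    refine Finset.sum_congr rfl fun u _ => ?_
    simp only [hk, Finset.mul_sum]
    exact Finset.sum_congr rfl fun x _ => by ring
  have hG2 : (∑ x ∈ X, g x ^ 2) ^ 2 ≤ E * ∑ u ∈ U, k u ^ 2 := by
    rw [hG, hE1]
    exact Finset.sum_mul_sq_le_sq_mul_sq _ _ _
  have hK : ∑ u ∈ U, k u ^ 2 ≤ X.card * V := by
    have e1 : ∀ u, k u = ∑ y ∈ X, ∑ x ∈ X, B x u * T x y := fun u => by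
      simp only [hk, hg, Finset.mul_sum]
      exact Finset.sum_comm
    have e2 : ∀ u, k u ^ 2 ≤ X.card * ∑ y ∈ X, (∑ x ∈ X, B x u * T x y) ^ 2 := fun u => by
      rw [e1]
      exact sq_sum_le_card_mul_sum_sq
    refine (Finset.sum_le_sum fun u _ => e2 u).trans_eq ?_
    rw [← Finset.mul_sum, Finset.sum_comm]
    congr 1
    calc _ = ∑ y ∈ X, ∑ x ∈ X, ∑ z ∈ X, T x z * T x y * T z y := by
          refine Finset.sum_congr rfl fun y _ => ?_
          simp_rw [sq, Finset.sum_mul_sum]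
          rw [Finset.sum_comm]
          refine Finset.sum_congr rfl fun x hx => ?_
          rw [Finset.sum_comm]
          refine Finset.sum_congr rfl fun z hz => ?_
          rw [hT x hx z hz, Finset.sum_mul, Finset.sum_mul]
          exact Finset.sum_congr rfl fun u _ => by ring
      _ = V := by
          rw [Finset.sum_comm]
          refine Finset.sum_congr rfl fun x _ => ?_
          refine Finset.sum_congr rfl fun y hy => Finset.sum_congr rfl fun z hz => ?_
          rw [hsymm z hz y hy]; ring
  rcases hE0.eq_or_lt with h0 | h0
  · have : 0 ≤ X.card * V := le_trans (by positivity) hK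
    rw [← h0]
    calc (0:ℝ) ^ 3 ≤ (X.card : ℝ) ^ 2 * (X.card * V) := by
          rw [zero_pow three_ne_zero]; positivity
      _ = _ := by ring
  · refine le_of_mul_le_mul_left ?_ h0
    calc E * E ^ 3 = (E ^ 2) ^ 2 := by ring
      _ ≤ (X.card * ∑ x ∈ X, g x ^ 2) ^ 2 := by gcongr
      _ = (X.card : ℝ) ^ 2 * (∑ x ∈ X, g x ^ 2) ^ 2 := by ring
      _ ≤ (X.card : ℝ) ^ 2 * (E * ∑ u ∈ U, k u ^ 2) := by gcongr
      _ ≤ (X.card : ℝ) ^ 2 * (E * (X.card * V)) := by gcongr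
      _ = _ := by ring

/-- `r(x - y)` counts the `u` with `u - x, u - y ∈ A`, so it is the Gram matrix of the indicators of
`x + A`. -/
theorem cube_addEnergy_le {G : Type*} [AddCommGroup G] [DecidableEq G] (A : Finset G) :
    (Finset.addEnergy A A : ℝ) ^ 3 ≤ (A.card : ℝ) ^ 3 * ∑ x ∈ A, ∑ y ∈ A, ∑ z ∈ A,
      (diffRep A (x - y) : ℝ) * diffRep A (x - z) * diffRep A (y - z) := by
  have hE : (Finset.addEnergy A A : ℝ) = ∑ x ∈ A, ∑ y ∈ A, (diffRep A (x - y) : ℝ) := by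
    rw [← sum_diffRep_sq, ← sum_diffRep_mul A fun d => (diffRep A d : ℝ)]
    simp_rw [sq]
  rw [hE]
  refine cube_sum_gram_le A (A + A) (fun x u => if u - x ∈ A then 1 else 0)
    (fun x y => (diffRep A (x - y) : ℝ)) fun x hx y hy => ?_
  simp only [diffRep, mul_ite, mul_one, mul_zero, ← ite_and, Finset.sum_boole]
  norm_cast
  refine Finset.card_nbij' (fun v => v + x) (fun u => u - x) ?_ ?_ ?_ ?_
  · intro v hv
    simp only [Finset.coe_filter, Set.mem_ofPred_eq] at hv ⊢
    refine ⟨Finset.add_mem_add hv.1 hx, ?_, by simpa using hv.1⟩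
    rw [add_sub_assoc]
    exact hv.2
  · intro u hu
    simp only [Finset.coe_filter, Set.mem_ofPred_eq] at hu ⊢
    refine ⟨hu.2.2, ?_⟩
    rw [show u - x + (x - y) = u - y by abel]
    exact hu.2.1
  · intro v _
    simp
  · intro v _
    simp

/-- Triangle bound: `E(A)⁶ ≤ |A|⁶ E₃(A) ∑ r(s)² r(t)² r(s - t)²`. -/
theorem addEnergy_pow_six_le {G : Type*} [AddCommGroup G] [DecidableEq G] (A : Finset G) :
    (Finset.addEnergy A A : ℝ) ^ 6 ≤ (A.card : ℝ) ^ 6 *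
      ((∑ d ∈ A - A, (diffRep A d : ℝ) ^ 3) * ∑ s ∈ A - A, ∑ t ∈ A - A,
        ((diffRep A s : ℝ) * diffRep A t * diffRep A (s - t)) ^ 2) := by
  have h := sq_sum_triangle_le A fun s t => (diffRep A s : ℝ) * diffRep A t * diffRep A (s - t)
  have h2 : ∀ x y z : G, diffRep A (x - y - (x - z)) = diffRep A (y - z) := fun x y z => by
    rw [diffRep_sub_comm A y z]; congr 1; abel
  simp only [h2] at h
  have h3 := pow_le_pow_left₀ (by positivity) (cube_addEnergy_le A) 2
  rw [← pow_mul, mul_pow, ← pow_mul] at h3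
  exact h3.trans (mul_le_mul_of_nonneg_left h (by positivity))

/-! ### An asymmetric Balog–Szemerédi–Gowers lemma -/

open Finset in
/-- Most pairs of neighbours of a well chosen vertex have many common neighbours. -/
theorem exists_subset_many_paths {α β : Type*} [DecidableEq α] [DecidableEq β]
    (X : Finset α) (Y : Finset β) (R : α → β → Prop) [∀ x y, Decidable (R x y)] {Q : ℝ}
    (hQ : Q = ∑ y ∈ Y, (#{x ∈ X | R x y} : ℝ)) (hQ0 : 0 < Q) :
    ∃ X' ⊆ X, Q ≤ 4 * (#X' * #Y) ∧ ∀ x ∈ X', ∀ x' ∈ X', Q ≤ 4 * (#Y *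
      #{z ∈ X | Q ^ 2 / (16 * (#X : ℝ) ^ 2 * #Y) ≤ #{y ∈ Y | R x y ∧ R z y} ∧
        Q ^ 2 / (16 * (#X : ℝ) ^ 2 * #Y) ≤ #{y ∈ Y | R x' y ∧ R z y}}) := by
  set θ : ℝ := Q ^ 2 / (16 * (#X : ℝ) ^ 2 * #Y) with hθ
  have hY : Y.Nonempty := by
    rw [nonempty_iff_ne_empty]; rintro rfl; simp [hQ] at hQ0
  have hX : X.Nonempty := by
    rw [nonempty_iff_ne_empty]; rintro rfl; simp [hQ] at hQ0
  have hYc : (0 : ℝ) < #Y := by exact_mod_cast hY.card_pos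
  have hXc : (0 : ℝ) < #X := by exact_mod_cast hX.card_pos
  set N : β → Finset α := fun y => {x ∈ X | R x y} with hN
  set bad : α → α → Prop := fun x z => (#{y ∈ Y | R x y ∧ R z y} : ℝ) < θ with hbad
  classical
  have hcs : Q ^ 2 ≤ #Y * ∑ y ∈ Y, (#(N y) : ℝ) ^ 2 := by
    rw [hQ]; exact sq_sum_le_card_mul_sum_sq
  have hsum : ∑ y ∈ Y, (#{p ∈ N y ×ˢ N y | bad p.1 p.2} : ℝ) ≤ θ * (#X : ℝ) ^ 2 := by
    have e1 : ∀ y ∈ Y, (#{p ∈ N y ×ˢ N y | bad p.1 p.2} : ℝ) =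
        ∑ p ∈ X ×ˢ X, if bad p.1 p.2 ∧ R p.1 y ∧ R p.2 y then (1 : ℝ) else 0 := by
      intro y _
      rw [sum_boole]
      congr 2
      ext p
      simp only [hN, mem_filter, mem_product]
      tauto
    rw [sum_congr rfl e1, sum_comm]
    calc _ ≤ ∑ p ∈ X ×ˢ X, θ := by
          refine sum_le_sum fun p _ => ?_
          by_cases hb : bad p.1 p.2
          · simp only [hb, true_and, sum_boole]
            exact hb.le
          · simp only [hb, false_and, if_false, sum_const_zero]
            positivity
      _ = _ := by simp [sq]; ring
  -- Averaging over `y`: `∑ |N y|² ≥ Q²/|Y|`, while the choice of `θ` keeps the bad pairs below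
  -- `Q²/(16|Y|)` in total, so eight times their number still leaves half.
  obtain ⟨y, _, hy⟩ : ∃ y ∈ Y, Q ^ 2 / (2 * (#Y : ℝ) ^ 2) ≤
      (#(N y) : ℝ) ^ 2 - 8 * #{p ∈ N y ×ˢ N y | bad p.1 p.2} := by
    apply exists_le_of_sum_le hY
    rw [sum_const, sum_sub_distrib, ← mul_sum, nsmul_eq_mul]
    have h1 : Q ^ 2 / #Y ≤ ∑ y ∈ Y, (#(N y) : ℝ) ^ 2 := by
      rw [div_le_iff₀ hYc]; linarith
    have h2 : θ * (#X : ℝ) ^ 2 = Q ^ 2 / #Y / 16 := by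
      rw [hθ]; field_simp
    have h3 : #Y * (Q ^ 2 / (2 * (#Y : ℝ) ^ 2)) = Q ^ 2 / #Y / 2 := by
      field_simp
    rw [h3]
    linarith
  have hNpos : Q ≤ 2 * (#Y * #(N y)) := by
    have : Q ^ 2 / (2 * (#Y : ℝ) ^ 2) ≤ (#(N y) : ℝ) ^ 2 :=
      hy.trans (sub_le_self _ (by positivity))
    rw [div_le_iff₀ (by positivity)] at this
    refine le_of_sq_le_sq ?_ (by positivity)
    nlinarith [sq_nonneg ((#Y : ℝ) * #(N y))]
  have hb8 : 8 * (#{p ∈ N y ×ˢ N y | bad p.1 p.2} : ℝ) ≤ (#(N y) : ℝ) ^ 2 := by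
    have : 0 ≤ Q ^ 2 / (2 * (#Y : ℝ) ^ 2) := by positivity
    linarith
  -- At most `|N y|²/8` pairs are bad, so at least half of `N y` survives. Two survivors together
  -- spoil at most half of the `z ∈ N y`.
  set X' : Finset α := {x ∈ N y | 4 * #{z ∈ N y | bad x z} ≤ #(N y)} with hX'
  have hn0 : (0 : ℝ) < #(N y) := by
    by_contra h
    have : (#(N y) : ℝ) = 0 := le_antisymm (not_lt.1 h) (by positivity)
    rw [this] at hNpos
    linarith
  have hhalf : (#(N y) : ℝ) ≤ 2 * #X' := by
    have e1 : (#{p ∈ N y ×ˢ N y | bad p.1 p.2} : ℝ) = ∑ x ∈ N y, (#{z ∈ N y | bad x z} : ℝ) := by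
      rw [card_filter, sum_product]
      simp_rw [card_filter]
      push_cast
      rfl
    have e2 : ∑ x ∈ {x ∈ N y | ¬ 4 * #{z ∈ N y | bad x z} ≤ #(N y)}, (#(N y) : ℝ) / 4 ≤
        ∑ x ∈ N y, (#{z ∈ N y | bad x z} : ℝ) := by
      refine le_trans (sum_le_sum fun x hx => ?_)
        (sum_le_sum_of_subset_of_nonneg (filter_subset _ _) fun _ _ _ => by positivity)
      have : (#(N y) : ℝ) < 4 * #{z ∈ N y | bad x z} := by
        exact_mod_cast not_le.1 (mem_filter.1 hx).2
      linarith
    rw [sum_const, nsmul_eq_mul, ← e1] at e2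
    have e3 : (#X' : ℝ) + #{x ∈ N y | ¬ 4 * #{z ∈ N y | bad x z} ≤ #(N y)} = #(N y) := by
      rw [hX']
      exact_mod_cast card_filter_add_card_filter_not (s := N y)
        (fun x => 4 * #{z ∈ N y | bad x z} ≤ #(N y))
    by_contra hlt
    nlinarith
  refine ⟨X', (filter_subset _ _).trans (filter_subset _ _), ?_, ?_⟩
  · nlinarith
  · intro x hx x' hx'
    refine hNpos.trans ?_
    have hsub : N y ⊆ {z ∈ X | θ ≤ (#{y ∈ Y | R x y ∧ R z y} : ℝ) ∧
        θ ≤ (#{y ∈ Y | R x' y ∧ R z y} : ℝ)} ∪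
        ({z ∈ N y | bad x z} ∪ {z ∈ N y | bad x' z}) := by
      intro z hz
      have hzX : z ∈ X := (mem_filter.1 hz).1
      simp only [mem_union, mem_filter, hz, hzX, true_and, hbad]
      by_cases h1 : (#{y ∈ Y | R x y ∧ R z y} : ℝ) < θ
      · exact Or.inr (Or.inl h1)
      · by_cases h2 : (#{y ∈ Y | R x' y ∧ R z y} : ℝ) < θ
        · exact Or.inr (Or.inr h2)
        · exact Or.inl ⟨not_lt.1 h1, not_lt.1 h2⟩
    have hc := (card_le_card hsub).trans
      ((card_union_le _ _).trans (Nat.add_le_add_left (card_union_le _ _) _))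
    have h1 := (mem_filter.1 hx).2
    have h2 := (mem_filter.1 hx').2
    have h3 : #(N y) ≤ 2 * #{z ∈ X | θ ≤ (#{y ∈ Y | R x y ∧ R z y} : ℝ) ∧
        θ ≤ (#{y ∈ Y | R x' y ∧ R z y} : ℝ)} := by omega
    have h4 : (#(N y) : ℝ) ≤ 2 * #{z ∈ X | θ ≤ (#{y ∈ Y | R x y ∧ R z y} : ℝ) ∧
        θ ≤ (#{y ∈ Y | R x' y ∧ R z y} : ℝ)} := by exact_mod_cast h3
    nlinarith

open Finset in
/-- Balog–Szemerédi–Gowers for the differences `s - t ∈ P₃` with `s ∈ P₁` and `t ∈ P₂`. -/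
theorem exists_subset_card_sub_le {G : Type*} [AddCommGroup G] [DecidableEq G]
    (P₁ P₂ P₃ : Finset G) {Q : ℝ} (hQ : Q = ∑ t ∈ P₂, (#{s ∈ P₁ | s - t ∈ P₃} : ℝ))
    (hQ0 : 0 < Q) :
    ∃ P ⊆ P₁, Q ≤ 4 * (#P * #P₂) ∧
      #(P - P) * Q ^ 5 ≤ 2 ^ 10 * ((#P₃ : ℝ) ^ 4 * (#P₁ : ℝ) ^ 4 * (#P₂ : ℝ) ^ 3) := by
  obtain ⟨P, hPs, hP, hpath⟩ :=
    exists_subset_many_paths P₁ P₂ (fun s t => s - t ∈ P₃) hQ hQ0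
  refine ⟨P, hPs, hP, ?_⟩
  have h2 : (0 : ℝ) < #P₂ := by
    have : P₂.Nonempty := by
      rw [nonempty_iff_ne_empty]; rintro rfl; simp [hQ] at hQ0
    exact_mod_cast this.card_pos
  have h1 : (0 : ℝ) < #P₁ := by
    have : P₁.Nonempty := by
      rw [nonempty_iff_ne_empty]; rintro rfl; simp [hQ] at hQ0
    exact_mod_cast this.card_pos
  set θ : ℝ := Q ^ 2 / (16 * (#P₁ : ℝ) ^ 2 * #P₂) with hθ
  have hθ0 : 0 ≤ θ := by positivity
  set W : Finset (G × G × G × G) := P₃ ×ˢ P₃ ×ˢ P₃ ×ˢ P₃ with hW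
  -- Each path `s, y, z, y', s'` writes `s - s' = (s - y) - (z - y) + (z - y') - (s' - y')` with all
  -- four terms in `P₃`; for fixed `s, s'` the terms determine the path.
  have key : ∀ d ∈ P - P, Q / (4 * #P₂) * θ ^ 2 ≤
      (#{w ∈ W | w.1 - w.2.1 + w.2.2.1 - w.2.2.2 = d} : ℝ) := by
    intro d hd
    obtain ⟨s, hs, s', hs', rfl⟩ := mem_sub.1 hd
    set Z : Finset G := {z ∈ P₁ | θ ≤ (#{y ∈ P₂ | s - y ∈ P₃ ∧ z - y ∈ P₃} : ℝ) ∧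
        θ ≤ (#{y ∈ P₂ | s' - y ∈ P₃ ∧ z - y ∈ P₃} : ℝ)} with hZ
    have hZc : Q / (4 * #P₂) ≤ #Z := by
      rw [div_le_iff₀ (by positivity)]
      linarith [hpath s hs s' hs']
    set I : Finset (Σ _ : G, G × G) := Z.sigma fun z =>
      {y ∈ P₂ | s - y ∈ P₃ ∧ z - y ∈ P₃} ×ˢ {y ∈ P₂ | s' - y ∈ P₃ ∧ z - y ∈ P₃} with hI
    have hIc : #I ≤ #{w ∈ W | w.1 - w.2.1 + w.2.2.1 - w.2.2.2 = s - s'} := by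
      refine card_le_card_of_injOn (fun i =>
        (s - i.2.1, i.1 - i.2.1, i.1 - i.2.2, s' - i.2.2)) ?_ ?_
      · intro i hi
        simp only [hI, mem_coe, mem_sigma, mem_product, mem_filter] at hi
        simp only [hW, mem_coe, mem_filter, mem_product]
        exact ⟨⟨hi.2.1.2.1, hi.2.1.2.2, hi.2.2.2.2, hi.2.2.2.1⟩, by abel⟩
      · rintro ⟨z, u, v⟩ _ ⟨z', u', v'⟩ _ h
        simp only [Prod.mk.injEq, sub_right_inj] at h
        obtain ⟨rfl, h2, _, rfl⟩ := h
        obtain rfl := sub_left_inj.1 h2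
        rfl
    calc Q / (4 * #P₂) * θ ^ 2 ≤ #Z * θ ^ 2 := by gcongr
      _ = ∑ z ∈ Z, θ * θ := by rw [sum_const, nsmul_eq_mul, sq]
      _ ≤ ∑ z ∈ Z, (#{y ∈ P₂ | s - y ∈ P₃ ∧ z - y ∈ P₃} : ℝ) *
            #{y ∈ P₂ | s' - y ∈ P₃ ∧ z - y ∈ P₃} := by
          refine sum_le_sum fun z hz => ?_
          have := (mem_filter.1 hz).2
          exact mul_le_mul this.1 this.2 hθ0 (by positivity)
      _ = #I := by simp [hI, card_sigma, card_product]
      _ ≤ _ := by exact_mod_cast hIc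
  have hsum : #(P - P) * (Q / (4 * #P₂) * θ ^ 2) ≤ (#P₃ : ℝ) ^ 4 := by
    calc _ = ∑ d ∈ P - P, Q / (4 * #P₂) * θ ^ 2 := by rw [sum_const, nsmul_eq_mul]
      _ ≤ ∑ d ∈ P - P, (#{w ∈ W | w.1 - w.2.1 + w.2.2.1 - w.2.2.2 = d} : ℝ) := sum_le_sum key
      _ ≤ #W := by
          norm_cast
          rw [sum_card_fiberwise_eq_card_filter W (P - P)
            fun w => w.1 - w.2.1 + w.2.2.1 - w.2.2.2]
          exact card_filter_le _ _
      _ = (#P₃ : ℝ) ^ 4 := by simp only [hW, card_product]; push_cast; ring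
  have e : Q / (4 * #P₂) * θ ^ 2 = Q ^ 5 / (2 ^ 10 * ((#P₁ : ℝ) ^ 4 * (#P₂ : ℝ) ^ 3)) := by
    rw [hθ]; field_simp; norm_num
  rw [e, ← mul_div_assoc, div_le_iff₀ (by positivity)] at hsum
  linarith

/-! ### Popular triples -/

section Triples

variable {G : Type*} [AddCommGroup G] {D : Finset G} {f : G → ℝ}

theorem sum_triples_swap_left (hf : ∀ x, f (-x) = f x) (F : ℝ → ℝ → ℝ → ℝ) :
    ∑ s ∈ D, ∑ t ∈ D, F (f s) (f t) (f (s - t)) = ∑ s ∈ D, ∑ t ∈ D, F (f t) (f s) (f (s - t)) := by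
  rw [Finset.sum_comm]
  refine Finset.sum_congr rfl fun s _ => Finset.sum_congr rfl fun t _ => ?_
  rw [← neg_sub, hf]

/-- Substitute `t ↦ s - t`; the vanishing of `F` removes the terms where one of `t`, `s - t` leaves
`D`. With the swap of `s` and `t` this generates all six permutations of the heights. -/
theorem sum_triples_swap_right (hD : ∀ x ∉ D, f x = 0) (F : ℝ → ℝ → ℝ → ℝ)
    (hF₂ : ∀ a c, F a 0 c = 0) (hF₃ : ∀ a b, F a b 0 = 0) :
    ∑ s ∈ D, ∑ t ∈ D, F (f s) (f t) (f (s - t)) = ∑ s ∈ D, ∑ t ∈ D, F (f s) (f (s - t)) (f t) := by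
  classical
  refine Finset.sum_congr rfl fun s _ => ?_
  have h1 : ∑ t ∈ D, F (f s) (f t) (f (s - t)) =
      ∑ t ∈ D with s - t ∈ D, F (f s) (f t) (f (s - t)) := by
    rw [Finset.sum_filter]
    refine Finset.sum_congr rfl fun t _ => ?_
    split_ifs with h
    · rfl
    · rw [hD _ h, hF₃]
  have h2 : ∑ t ∈ D, F (f s) (f (s - t)) (f t) =
      ∑ t ∈ D with s - t ∈ D, F (f s) (f (s - t)) (f t) := by
    rw [Finset.sum_filter]
    refine Finset.sum_congr rfl fun t _ => ?_
    split_ifs with h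
    · rfl
    · rw [hD _ h, hF₂]
  rw [h1, h2]
  refine Finset.sum_nbij' (fun t => s - t) (fun t => s - t) ?_ ?_ ?_ ?_ ?_ <;>
    simp +contextual

/-- By symmetry a sixth of the triples are ordered. -/
theorem sum_triples_le_ordered (hf : ∀ x, f (-x) = f x) (hD : ∀ x ∉ D, f x = 0) :
    ∑ s ∈ D, ∑ t ∈ D, (f s * f t * f (s - t)) ^ 2 ≤ 6 * ∑ s ∈ D, ∑ t ∈ D,
      if f (s - t) ≤ f s ∧ f s ≤ f t then (f s * f t * f (s - t)) ^ 2 else 0 := by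
  set F : ℝ → ℝ → ℝ → ℝ := fun a b c => if c ≤ a ∧ a ≤ b then (a * b * c) ^ 2 else 0 with hF
  have z1 : ∀ b c, F 0 b c = 0 := fun b c => by simp [hF]
  have z2 : ∀ a c, F a 0 c = 0 := fun a c => by simp [hF]
  have z3 : ∀ a b, F a b 0 = 0 := fun a b => by simp [hF]
  have s1 := sum_triples_swap_left (D := D) hf F
  have s2 := sum_triples_swap_right hD F z2 z3
  have s3 := sum_triples_swap_left (D := D) hf fun a b c => F a c b
  have s4 := sum_triples_swap_right hD (fun a b c => F b a c) z1 fun a b => z3 b a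
  have s5 := sum_triples_swap_left (D := D) hf fun a b c => F c a b
  have hle : ∀ a b c : ℝ, (a * b * c) ^ 2 ≤
      F a b c + F b a c + F a c b + F b c a + F c a b + F c b a := by
    intro a b c
    have n : ∀ a b c, 0 ≤ F a b c := fun a b c => by simp only [hF]; positivity
    have p : ∀ a b c, c ≤ a → a ≤ b → F a b c = (a * b * c) ^ 2 := fun a b c h h' => by
      simp [hF, h, h']
    have := n a b c; have := n b a c; have := n a c b
    have := n b c a; have := n c a b; have := n c b a
    rcases le_total a b with h1 | h1 <;> rcases le_total b c with h2 | h2 <;>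
      rcases le_total a c with h3 | h3
    · have := p b c a h1 h2; rw [show a * b * c = b * c * a by ring]; linarith
    · have := p b c a h1 h2; rw [show a * b * c = b * c * a by ring]; linarith
    · have := p c b a h3 h2; rw [show a * b * c = c * b * a by ring]; linarith
    · have := p a b c h3 h1; linarith
    · have := p a c b h1 h3; rw [show a * b * c = a * c * b by ring]; linarith
    · have := p c a b h2 h3; rw [show a * b * c = c * a * b by ring]; linarith
    · have := p b a c h2 h1; rw [show a * b * c = b * a * c by ring]; linarith
    · have := p b a c h2 h1; rw [show a * b * c = b * a * c by ring]; linarith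
  calc _ ≤ ∑ s ∈ D, ∑ t ∈ D, (F (f s) (f t) (f (s - t)) + F (f t) (f s) (f (s - t)) +
        F (f s) (f (s - t)) (f t) + F (f t) (f (s - t)) (f s) + F (f (s - t)) (f s) (f t) +
        F (f (s - t)) (f t) (f s)) :=
        Finset.sum_le_sum fun s _ => Finset.sum_le_sum fun t _ => hle _ _ _
    _ = 6 * ∑ s ∈ D, ∑ t ∈ D, F (f s) (f t) (f (s - t)) := by
        simp only [Finset.sum_add_distrib]
        linarith

/-- Among the triples there are many with comparable entries, the least of which is neither too
small nor too large. -/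
theorem le_sum_popular_triples (hf : ∀ x, f (-x) = f x) (hD : ∀ x ∉ D, f x = 0)
    (hf0 : ∀ x, 0 ≤ f x) {a ρ μ M ε T : ℝ} (ha : 0 < a) (hρ : 0 < ρ) (hμ : 1 ≤ μ)
    (hε : 0 < ε) (hT0 : 0 < T) (hT : 48 * μ * M ^ 2 ≤ T ^ (2 * ε))
    (h2 : ∑ x ∈ D, f x ^ 2 = a ^ 2 * ρ)
    (h3 : ∑ x ∈ D, f x ^ 3 ≤ 2 * μ * (a ^ 2 * ρ ^ 2))
    (hM : ∑ x ∈ D, f x ^ (3 + ε) = M * (a ^ 2 * ρ ^ (2 + ε)))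
    (hW : a ^ 4 * ρ ^ 4 / (2 * μ) ≤ ∑ s ∈ D, ∑ t ∈ D, (f s * f t * f (s - t)) ^ 2) :
    a ^ 4 * ρ ^ 4 / (48 * μ) ≤ ∑ s ∈ D, ∑ t ∈ D,
      if (f (s - t) ≤ f s ∧ f s ≤ f t) ∧ ρ / (7 * μ) ≤ f (s - t) ∧ f (s - t) ≤ T * ρ ∧
        f t ≤ 192 * μ ^ 3 * f (s - t) then (f s * f t * f (s - t)) ^ 2 else 0 := by
  have hμ0 : 0 < μ := by linarith
  set q : G → ℝ := fun x => if T * ρ < f x then f x ^ 3 else 0 with hq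
  have hq0 : ∀ x, 0 ≤ q x := fun x => by
    simp only [hq]; split_ifs
    · exact pow_nonneg (hf0 x) 3
    · exact le_rfl
  have hM0 : 0 ≤ M := by
    have : 0 ≤ M * (a ^ 2 * ρ ^ (2 + ε)) := by
      rw [← hM]; exact Finset.sum_nonneg fun x _ => Real.rpow_nonneg (hf0 x) _
    exact nonneg_of_mul_nonneg_left this (by positivity)
  have hqsum : ∑ x ∈ D, q x ≤ M * T ^ (-ε) * (a ^ 2 * ρ ^ 2) := by
    have : ∀ x, q x ≤ (T * ρ) ^ (-ε) * f x ^ (3 + ε) := by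
      intro x
      simp only [hq]
      split_ifs with h
      · have hx : 0 < f x := lt_trans (by positivity) h
        rw [Real.rpow_add hx, show f x ^ (3:ℝ) = f x ^ 3 by norm_cast, Real.rpow_neg (by positivity)]
        have : (T * ρ) ^ ε ≤ f x ^ ε := Real.rpow_le_rpow (by positivity) h.le hε.le
        rw [← div_eq_inv_mul, le_div_iff₀ (by positivity)]
        gcongr
      · exact mul_nonneg (by positivity) (Real.rpow_nonneg (hf0 x) _)
    refine (Finset.sum_le_sum fun x _ => this x).trans_eq ?_
    rw [← Finset.mul_sum, hM, Real.mul_rpow hT0.le hρ.le, Real.rpow_add hρ, Real.rpow_neg hρ.le,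
      show ρ ^ (2:ℝ) = ρ ^ 2 by norm_cast]
    have : ρ ^ ε ≠ 0 := by positivity
    field_simp
  have hqsq : (∑ x ∈ D, q x) ^ 2 ≤ a ^ 4 * ρ ^ 4 / (48 * μ) := by
    calc _ ≤ (M * T ^ (-ε) * (a ^ 2 * ρ ^ 2)) ^ 2 :=
          pow_le_pow_left₀ (Finset.sum_nonneg fun x _ => hq0 x) hqsum 2
      _ = M ^ 2 / T ^ (2 * ε) * (a ^ 4 * ρ ^ 4) := by
          rw [Real.rpow_neg hT0.le, two_mul, Real.rpow_add hT0]
          field_simp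
      _ ≤ 1 / (48 * μ) * (a ^ 4 * ρ ^ 4) := by
          refine mul_le_mul_of_nonneg_right ?_ (by positivity)
          rw [div_le_div_iff₀ (by positivity) (by positivity)]
          linarith
      _ = _ := by ring
  have hord := sum_triples_le_ordered hf hD
  -- An ordered triple is discarded if its least entry is below `ρ/(7μ)`, or above `Tρ`, or far
  -- below its largest. The second, truncated third and full third moments bound these losses; `7`,
  -- the condition on `T`, and `192` make each at most `a⁴ρ⁴/(48μ)`. A sixth of the whole is four
  -- such units, so one remains.
  have hpt : ∀ s t, (if f (s - t) ≤ f s ∧ f s ≤ f t then (f s * f t * f (s - t)) ^ 2 else 0) ≤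
      (if (f (s - t) ≤ f s ∧ f s ≤ f t) ∧ ρ / (7 * μ) ≤ f (s - t) ∧ f (s - t) ≤ T * ρ ∧
        f t ≤ 192 * μ ^ 3 * f (s - t) then (f s * f t * f (s - t)) ^ 2 else 0) +
      ((ρ / (7 * μ)) ^ 2 * (f s ^ 2 * f t ^ 2) + q s * q t +
        1 / (192 * μ ^ 3) * (f s ^ 3 * f t ^ 3)) := by
    intro s t
    have u0 := hf0 (s - t)
    have s0 := hf0 s
    have t0 := hf0 t
    have p1 : 0 ≤ (ρ / (7 * μ)) ^ 2 * (f s ^ 2 * f t ^ 2) := by positivity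
    have p2 : 0 ≤ q s * q t := mul_nonneg (hq0 s) (hq0 t)
    have p3 : 0 ≤ 1 / (192 * μ ^ 3) * (f s ^ 3 * f t ^ 3) := by positivity
    by_cases ho : f (s - t) ≤ f s ∧ f s ≤ f t
    swap
    · simp only [ho, false_and, if_false]; linarith
    obtain ⟨hus, hst⟩ := ho
    by_cases c1 : ρ / (7 * μ) ≤ f (s - t)
    swap
    · have hlow : (f s * f t * f (s - t)) ^ 2 ≤ (ρ / (7 * μ)) ^ 2 * (f s ^ 2 * f t ^ 2) := by
        calc (f s * f t * f (s - t)) ^ 2 = f (s - t) ^ 2 * (f s ^ 2 * f t ^ 2) := by ring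
          _ ≤ _ := by gcongr; exact (not_le.1 c1).le
      simp only [hus, hst, c1, and_self, if_true, false_and, and_false, if_false]
      linarith
    by_cases c2 : f (s - t) ≤ T * ρ
    swap
    · have hu := not_le.1 c2
      have hhigh : (f s * f t * f (s - t)) ^ 2 ≤ q s * q t := by
        simp only [hq, hu.trans_le hus, hu.trans_le (hus.trans hst), if_true]
        calc (f s * f t * f (s - t)) ^ 2 = f s ^ 2 * f t ^ 2 * (f (s - t) * f (s - t)) := by ring
          _ ≤ f s ^ 2 * f t ^ 2 * (f s * f t) := by
              gcongr
              exact hus.trans hst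
          _ = _ := by ring
      simp only [hus, hst, c1, c2, and_self, if_true, false_and, and_false, if_false]
      linarith
    by_cases c3 : f t ≤ 192 * μ ^ 3 * f (s - t)
    swap
    · have hratio : (f s * f t * f (s - t)) ^ 2 ≤ 1 / (192 * μ ^ 3) * (f s ^ 3 * f t ^ 3) := by
        have : f (s - t) ≤ 1 / (192 * μ ^ 3) * f t := by
          rw [one_div, ← div_eq_inv_mul, le_div_iff₀ (by positivity)]
          linarith
        calc (f s * f t * f (s - t)) ^ 2 = f s ^ 2 * f t ^ 2 * (f (s - t) * f (s - t)) := by ring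
          _ ≤ f s ^ 2 * f t ^ 2 * (f s * (1 / (192 * μ ^ 3) * f t)) := by gcongr
          _ = _ := by ring
      simp only [hus, hst, c1, c2, c3, and_self, if_true, and_false, if_false]
      linarith
    simp only [hus, hst, c1, c2, c3, and_self, if_true]
    linarith
  have hsum := Finset.sum_le_sum fun s (_ : s ∈ D) => Finset.sum_le_sum fun t (_ : t ∈ D) => hpt s t
  simp only [Finset.sum_add_distrib, ← Finset.mul_sum, ← Finset.sum_mul] at hsum
  have b1 : (ρ / (7 * μ)) ^ 2 * ((∑ x ∈ D, f x ^ 2) * ∑ x ∈ D, f x ^ 2) ≤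
      a ^ 4 * ρ ^ 4 / (48 * μ) := by
    rw [h2]
    calc _ = a ^ 4 * ρ ^ 4 / (49 * μ ^ 2) := by field_simp; norm_num
      _ ≤ _ := by
        refine div_le_div_of_nonneg_left (by positivity) (by positivity) ?_
        nlinarith
  have b3 : 1 / (192 * μ ^ 3) * ((∑ x ∈ D, f x ^ 3) * ∑ x ∈ D, f x ^ 3) ≤
      a ^ 4 * ρ ^ 4 / (48 * μ) := by
    have : 0 ≤ ∑ x ∈ D, f x ^ 3 := Finset.sum_nonneg fun x _ => pow_nonneg (hf0 x) 3
    calc _ ≤ 1 / (192 * μ ^ 3) * ((2 * μ * (a ^ 2 * ρ ^ 2)) * (2 * μ * (a ^ 2 * ρ ^ 2))) := by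
          gcongr
      _ = _ := by field_simp; norm_num
  have b2 : (∑ x ∈ D, q x) * ∑ x ∈ D, q x ≤ a ^ 4 * ρ ^ 4 / (48 * μ) := by
    rw [← sq]; exact hqsq
  have e : a ^ 4 * ρ ^ 4 / (2 * μ) = 24 * (a ^ 4 * ρ ^ 4 / (48 * μ)) := by
    field_simp; norm_num
  rw [e] at hW
  linarith

end Triples

/-- Dyadic-type pigeonholing of the popular triples, with ratio `b`. -/
theorem exists_levels_of_popular_triples {G : Type*} [AddCommGroup G] [DecidableEq G]
    {D : Finset G} {f : G → ℝ} (hD : ∀ x ∉ D, f x = 0) (hf0 : ∀ x, 0 ≤ f x)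
    {ρ μ T b S : ℝ} {J : ℕ} (hρ : 0 < ρ) (hμ : 0 < μ) (hb : 1 < b)
    (hJ : 192 * μ ^ 3 * T * (7 * μ) < b ^ J) (hS0 : 0 < S)
    (hS : S ≤ ∑ s ∈ D, ∑ t ∈ D,
      if (f (s - t) ≤ f s ∧ f s ≤ f t) ∧ ρ / (7 * μ) ≤ f (s - t) ∧ f (s - t) ≤ T * ρ ∧
        f t ≤ 192 * μ ^ 3 * f (s - t) then (f s * f t * f (s - t)) ^ 2 else 0) :
    ∃ l₁ l₂ l₃ : ℝ, 1 / (7 * μ) ≤ l₁ ∧ l₁ ≤ l₂ ∧ 1 / (7 * μ) ≤ l₃ ∧ l₃ ≤ T ∧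
      S ≤ (J : ℝ) ^ 3 * (b ^ 6 * (l₁ * l₂ * l₃) ^ 2 * ρ ^ 6 *
        ∑ t ∈ D with l₂ * ρ ≤ f t, ((({s ∈ D | l₁ * ρ ≤ f s} : Finset G).filter
          fun s => s - t ∈ ({u ∈ D | l₃ * ρ ≤ f u} : Finset G)).card : ℝ)) := by
  classical
  set κ := ρ / (7 * μ) with hκ
  have hκ0 : 0 < κ := by positivity
  have hb0 : 0 < b := by linarith
  -- Index of the geometric level of `f x`; the value `0` below `κ` is never used.
  have hlev : ∀ x, ∃ n : ℕ, κ ≤ f x → b ^ n * κ ≤ f x ∧ f x < b ^ (n + 1) * κ := by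
    intro x
    by_cases hx : κ ≤ f x
    · obtain ⟨n, h1, h2⟩ := exists_nat_pow_near ((one_le_div hκ0).2 hx) hb
      exact ⟨n, fun _ => ⟨(le_div_iff₀ hκ0).1 h1, (div_lt_iff₀ hκ0).1 h2⟩⟩
    · exact ⟨0, fun h => absurd h hx⟩
  choose j hj using hlev
  set R : Finset (G × G) := (D ×ˢ D).filter fun p =>
    (f (p.1 - p.2) ≤ f p.1 ∧ f p.1 ≤ f p.2) ∧ κ ≤ f (p.1 - p.2) ∧ f (p.1 - p.2) ≤ T * ρ ∧
        f p.2 ≤ 192 * μ ^ 3 * f (p.1 - p.2) with hR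
  set w : G × G → ℝ := fun p => (f p.1 * f p.2 * f (p.1 - p.2)) ^ 2 with hw
  set g : G × G → ℕ × ℕ × ℕ := fun p => (j p.1, j p.2, j (p.1 - p.2)) with hg
  set I : Finset (ℕ × ℕ × ℕ) := Finset.range J ×ˢ Finset.range J ×ˢ Finset.range J with hI
  have hS' : S ≤ ∑ p ∈ R, w p := by
    rw [hR, Finset.sum_filter, Finset.sum_product]
    exact hS
  have hltJ : ∀ x, κ ≤ f x → f x ≤ 192 * μ ^ 3 * (T * ρ) → j x < J := by
    intro x h1 h2
    have h3 : b ^ j x * κ < b ^ J * κ := by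
      refine ((hj x h1).1.trans h2).trans_lt ?_
      calc 192 * μ ^ 3 * (T * ρ) = 192 * μ ^ 3 * T * (7 * μ) * κ := by rw [hκ]; field_simp
        _ < _ := by gcongr
    exact (pow_lt_pow_iff_right₀ hb).1 (lt_of_mul_lt_mul_right h3 hκ0.le)
  have hmaps : ∀ p ∈ R, g p ∈ I := by
    intro p hp
    obtain ⟨_, ⟨h1, h2⟩, h3, h4, h5⟩ := Finset.mem_filter.1 hp
    have h6 : f p.2 ≤ 192 * μ ^ 3 * (T * ρ) := h5.trans (by gcongr)
    simp only [hI, hg, Finset.mem_product, Finset.mem_range]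
    exact ⟨hltJ _ (h3.trans h1) (h2.trans h6), hltJ _ (h3.trans (h1.trans h2)) h6,
      hltJ _ h3 ((h1.trans h2).trans h6)⟩
  have hIne : I.Nonempty := by
    have : R.Nonempty := by
      rw [Finset.nonempty_iff_ne_empty]
      intro h
      rw [h, Finset.sum_empty] at hS'
      linarith
    obtain ⟨p, hp⟩ := this
    exact ⟨_, hmaps p hp⟩
  have hIc : (I.card : ℝ) = (J : ℝ) ^ 3 := by
    simp only [hI, Finset.card_product, Finset.card_range]; push_cast; ring
  have hIc0 : (0 : ℝ) < (J : ℝ) ^ 3 := by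
    rw [← hIc]; exact_mod_cast hIne.card_pos
  obtain ⟨i, -, hi⟩ := Finset.exists_le_sum_fiber_of_maps_to_of_nsmul_le_sum (w := w)
    (b := S / (J : ℝ) ^ 3) hmaps hIne (by
      rw [nsmul_eq_mul, hIc, mul_div_cancel₀ _ hIc0.ne']; exact hS')
  set Φ := R.filter fun p => g p = i with hΦ
  have hΦne : Φ.Nonempty := by
    rw [Finset.nonempty_iff_ne_empty]
    intro h
    rw [h, Finset.sum_empty] at hi
    have : 0 < S / (J : ℝ) ^ 3 := by positivity
    linarith
  have hfacts : ∀ p ∈ Φ, p.1 ∈ D ∧ p.2 ∈ D ∧ p.1 - p.2 ∈ D ∧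
      b ^ i.1 * κ ≤ f p.1 ∧ f p.1 < b ^ (i.1 + 1) * κ ∧
      b ^ i.2.1 * κ ≤ f p.2 ∧ f p.2 < b ^ (i.2.1 + 1) * κ ∧
      b ^ i.2.2 * κ ≤ f (p.1 - p.2) ∧ f (p.1 - p.2) < b ^ (i.2.2 + 1) * κ ∧
      f p.1 ≤ f p.2 ∧ f (p.1 - p.2) ≤ T * ρ := by
    intro p hp
    obtain ⟨hpR, hpi⟩ := Finset.mem_filter.1 hp
    obtain ⟨hpD, ⟨h1, h2⟩, h3, h4, h5⟩ := Finset.mem_filter.1 hpR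
    rw [← hpi]
    have a1 := hj _ (h3.trans h1)
    have a2 := hj _ (h3.trans (h1.trans h2))
    have a3 := hj _ h3
    refine ⟨(Finset.mem_product.1 hpD).1, (Finset.mem_product.1 hpD).2, ?_, a1.1, a1.2, a2.1, a2.2,
      a3.1, a3.2, h2, h4⟩
    by_contra h
    rw [hD _ h] at h3
    linarith
  have hlρ : ∀ n : ℕ, b ^ n / (7 * μ) * ρ = b ^ n * κ := fun n => by rw [hκ]; ring
  have hlow : ∀ n : ℕ, 1 / (7 * μ) ≤ b ^ n / (7 * μ) := fun n => by
    gcongr; exact one_le_pow₀ hb.le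
  refine ⟨b ^ i.1 / (7 * μ), b ^ i.2.1 / (7 * μ), b ^ i.2.2 / (7 * μ), hlow _, ?_, hlow _, ?_, ?_⟩
  · obtain ⟨p, hp⟩ := hΦne
    obtain ⟨-, -, -, h1, -, -, h2, -, -, h3, -⟩ := hfacts p hp
    have : b ^ i.1 * κ < b ^ (i.2.1 + 1) * κ := (h1.trans h3).trans_lt h2
    have := (pow_lt_pow_iff_right₀ hb).1 (lt_of_mul_lt_mul_right this hκ0.le)
    gcongr
    · exact hb.le
    · omega
  · obtain ⟨p, hp⟩ := hΦne
    obtain ⟨-, -, -, -, -, -, -, h1, -, -, h2⟩ := hfacts p hp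
    refine le_of_mul_le_mul_right ?_ hρ
    rw [hlρ]
    exact h1.trans h2
  · rw [div_le_iff₀ hIc0] at hi
    refine hi.trans ?_
    rw [mul_comm]
    refine mul_le_mul_of_nonneg_left ?_ hIc0.le
    have hwle : ∀ p ∈ Φ, w p ≤ b ^ 6 * (b ^ i.1 / (7 * μ) * (b ^ i.2.1 / (7 * μ)) *
        (b ^ i.2.2 / (7 * μ))) ^ 2 * ρ ^ 6 := by
      intro p hp
      obtain ⟨-, -, -, -, h1, -, h2, -, h3, -, -⟩ := hfacts p hp
      calc w p = (f p.1 * f p.2 * f (p.1 - p.2)) ^ 2 := rfl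
        _ ≤ (b ^ (i.1 + 1) * κ * (b ^ (i.2.1 + 1) * κ) * (b ^ (i.2.2 + 1) * κ)) ^ 2 := by
          have := hf0 p.1
          have := hf0 p.2
          have := hf0 (p.1 - p.2)
          gcongr
        _ = _ := by rw [← hlρ, ← hlρ, ← hlρ]; ring
    refine (Finset.sum_le_sum hwle).trans ?_
    rw [Finset.sum_const, nsmul_eq_mul, mul_comm]
    refine mul_le_mul_of_nonneg_left ?_ (by positivity)
    norm_cast
    simp only [hlρ]
    rw [← Finset.card_sigma]
    refine Finset.card_le_card_of_injOn (fun p => ⟨p.2, p.1⟩) ?_ ?_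
    · intro p hp
      obtain ⟨d1, d2, d3, h1, -, h2, -, h3, -, -, -⟩ := hfacts p hp
      simp [d1, d2, d3, h1, h2, h3]
    · rintro ⟨x, y⟩ - ⟨x', y'⟩ - h
      simp only [Sigma.mk.injEq, heq_eq_eq] at h
      simp [h.1, h.2]

/-! ### Moment inequalities -/

section Moments

variable {ι : Type*} {D : Finset ι} {f : ι → ℝ}

/-- Interpolation: the third moment is controlled by the second and the `(3 + ε)`-th. -/
theorem sum_cube_le_of_moments (hf0 : ∀ x, 0 ≤ f x) {E ρ μ ε : ℝ} (hρ : 0 < ρ) (hμ : 0 < μ)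
    (hε : 0 < ε) (h2 : ∑ x ∈ D, f x ^ 2 = E * ρ)
    (hM : ∑ x ∈ D, f x ^ (3 + ε) = μ ^ (1 + ε) * (E * ρ ^ (2 + ε))) :
    ∑ x ∈ D, f x ^ 3 ≤ 2 * μ * (E * ρ ^ 2) := by
  -- Split at height `μρ`, where the contributions of the two given moments are equal.
  have hpt : ∀ x, f x ^ 3 ≤ μ * ρ * f x ^ 2 + (μ * ρ) ^ (-ε) * f x ^ (3 + ε) := by
    intro x
    have h0 := hf0 x
    rcases le_total (f x) (μ * ρ) with h | h
    · have : 0 ≤ (μ * ρ) ^ (-ε) * f x ^ (3 + ε) := by positivity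
      have : f x * f x ^ 2 ≤ μ * ρ * f x ^ 2 := by gcongr
      nlinarith
    · have hx : 0 < f x := lt_of_lt_of_le (by positivity) h
      have h1 : 0 ≤ μ * ρ * f x ^ 2 := by positivity
      have h4 : f x ^ 3 ≤ (μ * ρ) ^ (-ε) * f x ^ (3 + ε) := by
        rw [Real.rpow_add hx, show f x ^ (3:ℝ) = f x ^ 3 by norm_cast,
          Real.rpow_neg (by positivity), ← div_eq_inv_mul, le_div_iff₀ (by positivity)]
        gcongr
      linarith
  refine (Finset.sum_le_sum fun x _ => hpt x).trans_eq ?_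
  rw [Finset.sum_add_distrib, ← Finset.mul_sum, ← Finset.mul_sum, h2, hM,
    Real.mul_rpow hμ.le hρ.le, Real.rpow_neg hμ.le, Real.rpow_neg hρ.le, Real.rpow_add hμ,
    Real.rpow_add hρ, Real.rpow_one, show ρ ^ (2:ℝ) = ρ ^ 2 by norm_cast]
  have : ρ ^ ε ≠ 0 := by positivity
  have : μ ^ ε ≠ 0 := by positivity
  field_simp
  ring

/-- The `(p + 1)`-th moment is least when the mass sits at a single height. -/
theorem one_le_of_moments (hf0 : ∀ x, 0 ≤ f x) {E ρ M p : ℝ} (hE : 0 < E) (hρ : 0 < ρ)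
    (hp : 1 ≤ p) (h1 : ∑ x ∈ D, f x = E) (h2 : ∑ x ∈ D, f x ^ 2 = E * ρ)
    (hM : ∑ x ∈ D, f x ^ (1 + p) = M * (E * ρ ^ p)) : 1 ≤ M := by
  -- Jensen with weights `f x / E`, under which `f` has mean `ρ`.
  have h := Real.rpow_arith_mean_le_arith_mean_rpow D (fun x => f x / E) f
    (fun x _ => div_nonneg (hf0 x) hE.le) (by rw [← Finset.sum_div, h1, div_self hE.ne'])
    (fun x _ => hf0 x) hp
  have e1 : ∑ x ∈ D, f x / E * f x = ρ := by
    have : ∀ x ∈ D, f x / E * f x = f x ^ 2 / E := fun x _ => by ring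
    rw [Finset.sum_congr rfl this, ← Finset.sum_div, h2, mul_div_cancel_left₀ _ hE.ne']
  have e2 : ∑ x ∈ D, f x / E * f x ^ p = M * ρ ^ p := by
    have : ∀ x ∈ D, f x / E * f x ^ p = f x ^ (1 + p) / E := fun x _ => by
      rw [Real.rpow_add' (hf0 x) (by linarith), Real.rpow_one]; ring
    rw [Finset.sum_congr rfl this, ← Finset.sum_div, hM]
    field_simp
  rw [e1, e2] at h
  have : 0 < ρ ^ p := by positivity
  exact le_of_mul_le_mul_right (by linarith) this

theorem card_filter_le_of_sum_cube (hf0 : ∀ x, 0 ≤ f x) {l N : ℝ} (hl : 0 < l)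
    (h3 : ∑ x ∈ D, f x ^ 3 ≤ N) : ((D.filter fun x => l ≤ f x).card : ℝ) * l ^ 3 ≤ N := by
  calc _ = ∑ x ∈ D with l ≤ f x, l ^ 3 := by rw [Finset.sum_const, nsmul_eq_mul]
    _ ≤ ∑ x ∈ D with l ≤ f x, f x ^ 3 := Finset.sum_le_sum fun x hx => by
        have := (Finset.mem_filter.1 hx).2
        gcongr
    _ ≤ ∑ x ∈ D, f x ^ 3 := Finset.sum_le_sum_of_subset_of_nonneg (Finset.filter_subset _ _)
        fun x _ _ => pow_nonneg (hf0 x) 3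
    _ ≤ N := h3

end Moments

/-! ### From popular differences back to `A` -/

section Translate

variable {G : Type*} [AddCommGroup G] [DecidableEq G]

/-- A set of popular differences has a translate meeting `A` in many points. -/
theorem exists_translate_inter (A P : Finset G) (hA : A.Nonempty) {l : ℝ}
    (hP : ∀ s ∈ P, l ≤ diffRep A s) :
    ∃ y ∈ A, P.card * l ≤ (A.card : ℝ) * (A.filter fun x => x - y ∈ P).card := by
  have hA0 : (0 : ℝ) < A.card := by exact_mod_cast hA.card_pos
  obtain ⟨y, hy, h⟩ : ∃ y ∈ A, P.card * l / A.card ≤ ((A.filter fun x => x - y ∈ P).card : ℝ) := by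
    apply Finset.exists_le_of_sum_le hA
    rw [Finset.sum_const, nsmul_eq_mul, mul_div_cancel₀ _ hA0.ne']
    calc _ = ∑ s ∈ P, l := by rw [Finset.sum_const, nsmul_eq_mul]
      _ ≤ ∑ s ∈ P, (diffRep A s : ℝ) := Finset.sum_le_sum hP
      _ = ∑ y ∈ A, ((A.filter fun x => x - y ∈ P).card : ℝ) := by
        simp_rw [diffRep_eq_sum]
        rw [Finset.sum_comm]
        refine Finset.sum_congr rfl fun y _ => ?_
        rw [Finset.sum_boole]
        norm_cast
        refine Finset.card_nbij' (fun s => y + s) (fun x => x - y) ?_ ?_ ?_ ?_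
        · intro s hs
          simpa using And.symm (Finset.mem_filter.1 hs)
        · intro x hx
          simpa using And.symm (Finset.mem_filter.1 hx)
        · intro s _
          simp
        · intro s _
          simp
  exact ⟨y, hy, by rwa [div_le_iff₀' hA0] at h⟩

theorem iterSumset_eq_nsmul (n : ℕ) (A : Finset G) : iterSumset n A = n • A := by
  induction n with
  | zero => simp [iterSumset]; rfl
  | succ n ih => rw [iterSumset, ih, succ_nsmul]

theorem iterSumset_subset_translate {B P : Finset G} {y : G} (h : ∀ x ∈ B, x - y ∈ P) (n : ℕ) :
    ∀ x ∈ iterSumset n B, x - n • y ∈ iterSumset n P := by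
  induction n with
  | zero => simp [iterSumset]
  | succ n ih =>
    intro x hx
    obtain ⟨u, hu, v, hv, rfl⟩ := Finset.mem_add.1 hx
    have : u + v - (n + 1) • y = (u - n • y) + (v - y) := by rw [succ_nsmul]; abel
    rw [this]
    exact Finset.add_mem_add (ih u hu) (h v hv)

theorem card_iterSumset_sub_le_of_translate {B P : Finset G} {y : G} (h : ∀ x ∈ B, x - y ∈ P)
    (n m : ℕ) : (iterSumset n B - iterSumset m B).card ≤ (iterSumset n P - iterSumset m P).card := by
  refine Finset.card_le_card_of_injOn (fun x => x - (n • y - m • y)) ?_ (by simp [Set.InjOn])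
  intro x hx
  obtain ⟨u, hu, v, hv, rfl⟩ := Finset.mem_sub.1 (Finset.mem_coe.1 hx)
  have : u - v - (n • y - m • y) = (u - n • y) - (v - m • y) := by abel
  simp only [Finset.mem_coe, this]
  exact Finset.sub_mem_sub (iterSumset_subset_translate h n u hu)
    (iterSumset_subset_translate h m v hv)

theorem card_iterSumset_sub_le {P : Finset G} (hP : P.Nonempty) {L : ℝ}
    (hL : ((P - P).card : ℝ) ≤ L * P.card) (n m : ℕ) :
    ((iterSumset n P - iterSumset m P).card : ℝ) ≤ L ^ (n + m) * P.card := by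
  have hP0 : (0 : ℝ) < P.card := by exact_mod_cast hP.card_pos
  have h := Finset.pluennecke_ruzsa_inequality_nsmul_sub_nsmul_sub hP P n m
  have h' : ((n • P - m • P).card : ℝ) ≤
      (((P - P).card : ℝ) / P.card) ^ (n + m) * P.card := by
    have := (NNRat.cast_le (K := ℝ)).2 h
    push_cast at this
    exact this
  rw [iterSumset_eq_nsmul, iterSumset_eq_nsmul]
  refine h'.trans ?_
  gcongr
  rwa [div_le_iff₀ hP0]

end Translate

/-! ### Combining the estimates -/

/-- Multiplying `hdQ` by `hpQ` makes the right side symmetric, `(p₁p₂p₃)⁴ p` against `d Q⁶`. The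
sixth power of `hQ4` and the fourth power of `c₁c₂c₃` then both carry `(l₁l₂l₃)¹²`, so all heights
cancel. -/
theorem doubling_le_of_levels {a ρ μ σ l₁ l₂ l₃ p₁ p₂ p₃ p d Q : ℝ} (ha : 0 < a) (hρ : 0 < ρ)
    (hl₁ : 0 < l₁) (hl₂ : 0 < l₂) (hl₃ : 0 < l₃) (hp₁ : 0 ≤ p₁)
    (hp₂ : 0 ≤ p₂) (hp₃ : 0 ≤ p₃) (hp : 0 ≤ p) (hd : 0 ≤ d) (hQ : 0 ≤ Q)
    (hQ4 : a ^ 4 ≤ σ * (l₁ * l₂ * l₃) ^ 2 * ρ ^ 2 * Q)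
    (c₁ : p₁ * l₁ ^ 3 * ρ ≤ 2 * μ * a ^ 2) (c₂ : p₂ * l₂ ^ 3 * ρ ≤ 2 * μ * a ^ 2)
    (c₃ : p₃ * l₃ ^ 3 * ρ ≤ 2 * μ * a ^ 2) (hpQ : Q ≤ 4 * (p * p₂))
    (hdQ : d * Q ^ 5 ≤ 2 ^ 10 * (p₃ ^ 4 * p₁ ^ 4 * p₂ ^ 3)) :
    d ≤ 2 ^ 24 * σ ^ 6 * μ ^ 12 * p := by
  have hN : 0 ≤ 2 * μ * a ^ 2 := le_trans (by positivity) c₁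
  have hprod : p₁ * l₁ ^ 3 * ρ * (p₂ * l₂ ^ 3 * ρ) * (p₃ * l₃ ^ 3 * ρ) ≤
      2 * μ * a ^ 2 * (2 * μ * a ^ 2) * (2 * μ * a ^ 2) :=
    mul_le_mul (mul_le_mul c₁ c₂ (by positivity) hN) c₃ (by positivity) (by positivity)
  have h1 : (a ^ 4) ^ 6 ≤ (σ * (l₁ * l₂ * l₃) ^ 2 * ρ ^ 2 * Q) ^ 6 :=
    pow_le_pow_left₀ (by positivity) hQ4 6
  have h2 : d * Q ^ 5 * Q ≤ 2 ^ 10 * (p₃ ^ 4 * p₁ ^ 4 * p₂ ^ 3) * (4 * (p * p₂)) :=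
    mul_le_mul hdQ hpQ hQ (by positivity)
  refine le_of_mul_le_mul_left ?_ (by positivity : 0 < a ^ 24)
  calc a ^ 24 * d = (a ^ 4) ^ 6 * d := by ring
    _ ≤ (σ * (l₁ * l₂ * l₃) ^ 2 * ρ ^ 2 * Q) ^ 6 * d := mul_le_mul_of_nonneg_right h1 hd
    _ = σ ^ 6 * (l₁ * l₂ * l₃) ^ 12 * ρ ^ 12 * (d * Q ^ 5 * Q) := by ring
    _ ≤ σ ^ 6 * (l₁ * l₂ * l₃) ^ 12 * ρ ^ 12 *
        (2 ^ 10 * (p₃ ^ 4 * p₁ ^ 4 * p₂ ^ 3) * (4 * (p * p₂))) :=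
        mul_le_mul_of_nonneg_left h2 (by positivity)
    _ = 2 ^ 12 * σ ^ 6 * p * (p₁ * l₁ ^ 3 * ρ * (p₂ * l₂ ^ 3 * ρ) * (p₃ * l₃ ^ 3 * ρ)) ^ 4 := by
        ring
    _ ≤ 2 ^ 12 * σ ^ 6 * p * (2 * μ * a ^ 2 * (2 * μ * a ^ 2) * (2 * μ * a ^ 2)) ^ 4 :=
        mul_le_mul_of_nonneg_left (pow_le_pow_left₀ (by positivity) hprod 4) (by positivity)
    _ = a ^ 24 * (2 ^ 24 * σ ^ 6 * μ ^ 12 * p) := by ring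

/-- Here the heights cancel only up to `l₁l₃²/l₂`. The ordering `l₁ ≤ l₂` and the truncation `l₃ ≤
T` bound this by `T²`, the source of the `1/ε` in the exponent of `M` for `|A'|`. -/
theorem card_le_of_levels {a ρ μ σ T l₁ l₂ l₃ p₂ p q Q : ℝ} (ha : 0 < a) (hρ : 0 < ρ)
    (hσ : 0 ≤ σ) (hl₁ : 0 < l₁) (hl₁₂ : l₁ ≤ l₂) (hl₃ : 0 < l₃)
    (hl₃T : l₃ ≤ T) (hp₂ : 0 ≤ p₂) (hp : 0 ≤ p)
    (hQ4 : a ^ 4 ≤ σ * (l₁ * l₂ * l₃) ^ 2 * ρ ^ 2 * Q)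
    (c₂ : p₂ * l₂ ^ 3 * ρ ≤ 2 * μ * a ^ 2) (hpQ : Q ≤ 4 * (p * p₂)) (hpq : p * (l₁ * ρ) ≤ a * q) :
    a ≤ 8 * σ * μ * T ^ 2 * q := by
  have hl₂ : 0 < l₂ := hl₁.trans_le hl₁₂
  have hT : 0 < T := hl₃.trans_le hl₃T
  have h1 : p * (l₁ * ρ) * (p₂ * l₂ ^ 3 * ρ) ≤ a * q * (2 * μ * a ^ 2) :=
    mul_le_mul hpq c₂ (by positivity) (le_trans (by positivity) hpq)
  have h2 : l₁ * l₃ ^ 2 ≤ l₂ * T ^ 2 := by gcongr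
  refine le_of_mul_le_mul_left ?_ (by positivity : 0 < a ^ 3 * l₂)
  calc a ^ 3 * l₂ * a = l₂ * a ^ 4 := by ring
    _ ≤ l₂ * (σ * (l₁ * l₂ * l₃) ^ 2 * ρ ^ 2 * Q) := mul_le_mul_of_nonneg_left hQ4 hl₂.le
    _ ≤ l₂ * (σ * (l₁ * l₂ * l₃) ^ 2 * ρ ^ 2 * (4 * (p * p₂))) := by gcongr
    _ = 4 * σ * (l₁ * l₃ ^ 2) * (p * (l₁ * ρ) * (p₂ * l₂ ^ 3 * ρ)) := by ring
    _ ≤ 4 * σ * (l₂ * T ^ 2) * (p * (l₁ * ρ) * (p₂ * l₂ ^ 3 * ρ)) := by gcongr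
    _ ≤ 4 * σ * (l₂ * T ^ 2) * (a * q * (2 * μ * a ^ 2)) := by gcongr
    _ = _ := by ring

/-- The structural statement with the auxiliary parameters `ρ = |A| / K`, `ν ^ 6 = M ^ (1 / (1 + ε))`,
`T` and `J` left free. -/
theorem exists_subset_small_iterSumset {G : Type*} [AddCommGroup G] [DecidableEq G]
    {A : Finset G} (hA : A.Nonempty) {ρ ν ε T : ℝ} {J : ℕ} (hρ : 0 < ρ) (hν : 1 ≤ ν)
    (hε : 0 < ε) (hT0 : 0 < T) (hE : (Finset.addEnergy A A : ℝ) = (A.card : ℝ) ^ 2 * ρ)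
    (hM : higherEnergy (3 + ε) A = (ν ^ 6) ^ (1 + ε) * ((A.card : ℝ) ^ 2 * ρ ^ (2 + ε)))
    (hT : 48 * ν ^ 6 * ((ν ^ 6) ^ (1 + ε)) ^ 2 ≤ T ^ (2 * ε))
    (hJ : 192 * (ν ^ 6) ^ 3 * T * (7 * ν ^ 6) < (2 * ν) ^ J) :
    ∃ A' ⊆ A, (A.card : ℝ) ≤ 24576 * J ^ 3 * (ν ^ 6) ^ 3 * T ^ 2 * A'.card ∧
      ∀ n m : ℕ, ((iterSumset n A' - iterSumset m A').card : ℝ) ≤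
        (2 ^ 24 * (3072 * J ^ 3 * (ν ^ 6) ^ 2) ^ 6 * (ν ^ 6) ^ 12) ^ (n + m) *
          (7 * ν ^ 6) * (A.card / ρ) * A'.card := by
  obtain ⟨μ, hμdef⟩ : ∃ μ, μ = ν ^ 6 := ⟨_, rfl⟩
  have hμ : 1 ≤ μ := by rw [hμdef]; exact one_le_pow₀ hν
  have hb6 : (2 * ν) ^ 6 = 64 * μ := by rw [hμdef]; ring
  rw [← hμdef] at hM hT hJ ⊢
  have hμ0 : 0 < μ := by linarith
  obtain ⟨a, ha⟩ : ∃ a : ℝ, a = A.card := ⟨_, rfl⟩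
  have ha0 : 0 < a := by rw [ha]; exact_mod_cast hA.card_pos
  rw [← ha] at hE hM ⊢
  set f : G → ℝ := fun x => (diffRep A x : ℝ) with hf
  set D := A - A with hDdef
  have hf0 : ∀ x, 0 ≤ f x := fun x => by positivity
  have hfneg : ∀ x, f (-x) = f x := fun x => by simp only [hf, diffRep_neg]
  have hfD : ∀ x ∉ D, f x = 0 := fun x hx => by simp only [hf, diffRep_eq_zero hx, Nat.cast_zero]
  have h2 : ∑ x ∈ D, f x ^ 2 = a ^ 2 * ρ := by rw [← hE]; exact sum_diffRep_sq A
  have h3 : ∑ x ∈ D, f x ^ 3 ≤ 2 * μ * (a ^ 2 * ρ ^ 2) :=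
    sum_cube_le_of_moments hf0 hρ hμ0 hε h2 hM
  have hW : a ^ 4 * ρ ^ 4 / (2 * μ) ≤ ∑ s ∈ D, ∑ t ∈ D, (f s * f t * f (s - t)) ^ 2 := by
    have h6 := addEnergy_pow_six_le A
    rw [hE, ← ha] at h6
    set W := ∑ s ∈ D, ∑ t ∈ D, (f s * f t * f (s - t)) ^ 2 with hWdef
    have hW0 : 0 ≤ W := Finset.sum_nonneg fun _ _ => Finset.sum_nonneg fun _ _ => sq_nonneg _
    have h7 : (a ^ 2 * ρ) ^ 6 ≤ a ^ 6 * (2 * μ * (a ^ 2 * ρ ^ 2) * W) :=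
      h6.trans (by gcongr)
    rw [div_le_iff₀ (by positivity)]
    have h8 : a ^ 8 * ρ ^ 2 * (a ^ 4 * ρ ^ 4) ≤ a ^ 8 * ρ ^ 2 * (W * (2 * μ)) := by
      linarith
    exact le_of_mul_le_mul_left h8 (by positivity)
  have hpop := le_sum_popular_triples hfneg hfD hf0 ha0 hρ hμ hε hT0 hT h2 h3 hM hW
  obtain ⟨l₁, l₂, l₃, hl₁, hl₁₂, hl₃, hl₃T, hQ⟩ :=
    exists_levels_of_popular_triples hfD hf0 hρ hμ0 (by linarith : 1 < 2 * ν) hJ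
      (by positivity) hpop
  have hη : 0 < 1 / (7 * μ) := by positivity
  have hl₁0 : 0 < l₁ := hη.trans_le hl₁
  have hl₂0 : 0 < l₂ := hl₁0.trans_le hl₁₂
  have hl₃0 : 0 < l₃ := hη.trans_le hl₃
  set P₁ : Finset G := {x ∈ D | l₁ * ρ ≤ f x} with hP₁
  set P₂ : Finset G := {x ∈ D | l₂ * ρ ≤ f x} with hP₂
  set P₃ : Finset G := {x ∈ D | l₃ * ρ ≤ f x} with hP₃
  set Q : ℝ := ∑ t ∈ P₂, ((P₁.filter fun s => s - t ∈ P₃).card : ℝ) with hQdef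
  -- `3072 = 48 · 64`: the loss `48μ` of the popular triples times `(2ν)⁶ = 64μ` from the level
  -- width.
  obtain ⟨σ, hσ⟩ : ∃ σ : ℝ, σ = 3072 * J ^ 3 * μ ^ 2 := ⟨_, rfl⟩
  have hσ0 : 0 ≤ σ := by rw [hσ]; positivity
  have hQ4 : a ^ 4 ≤ σ * (l₁ * l₂ * l₃) ^ 2 * ρ ^ 2 * Q := by
    rw [hb6, div_le_iff₀ (by positivity)] at hQ
    have : ρ ^ 4 * a ^ 4 ≤ ρ ^ 4 * (σ * (l₁ * l₂ * l₃) ^ 2 * ρ ^ 2 * Q) := by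
      rw [hσ]; linarith
    exact le_of_mul_le_mul_left this (by positivity)
  have hQ0 : 0 < Q := by
    by_contra h
    have : σ * (l₁ * l₂ * l₃) ^ 2 * ρ ^ 2 * Q ≤ 0 :=
      mul_nonpos_of_nonneg_of_nonpos (by positivity) (not_lt.1 h)
    have : 0 < a ^ 4 := by positivity
    linarith
  have hcard : ∀ l : ℝ, 0 < l → (({x ∈ D | l * ρ ≤ f x} : Finset G).card : ℝ) * l ^ 3 * ρ ≤
      2 * μ * a ^ 2 := by
    intro l hl
    have := card_filter_le_of_sum_cube hf0 (mul_pos hl hρ) h3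
    refine le_of_mul_le_mul_left ?_ (by positivity : 0 < ρ ^ 2)
    linarith
  have c1 := hcard l₁ hl₁0
  have c2 := hcard l₂ hl₂0
  have c3 := hcard l₃ hl₃0
  rw [← hP₁] at c1
  rw [← hP₂] at c2
  rw [← hP₃] at c3
  obtain ⟨P, hPs, hPQ, hPP⟩ := exists_subset_card_sub_le P₁ P₂ P₃ hQdef hQ0
  have hPne : P.Nonempty := by
    rw [Finset.nonempty_iff_ne_empty]
    rintro rfl
    simp only [Finset.card_empty, Nat.cast_zero, zero_mul, mul_zero] at hPQ
    linarith
  obtain ⟨L, hL⟩ : ∃ L : ℝ, L = 2 ^ 24 * σ ^ 6 * μ ^ 12 := ⟨_, rfl⟩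
  have hL0 : 0 ≤ L := by rw [hL]; positivity
  have hdoubling : ((P - P).card : ℝ) ≤ L * P.card :=
    hL ▸ doubling_le_of_levels ha0 hρ hl₁0 hl₂0 hl₃0 (by positivity) (by positivity) (by positivity)
      (by positivity) (by positivity) hQ0.le hQ4 c1 c2 c3 hPQ hPP
  obtain ⟨y, -, hy⟩ := exists_translate_inter A P hA (l := l₁ * ρ) fun s hs =>
    (Finset.mem_filter.1 (hPs hs)).2
  rw [← ha] at hy
  set A' := A.filter fun x => x - y ∈ P with hA'
  refine ⟨A', Finset.filter_subset _ _, ?_, ?_⟩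
  · refine (card_le_of_levels ha0 hρ hσ0 hl₁0 hl₁₂ hl₃0 hl₃T (by positivity) (by positivity) hQ4 c2
      hPQ hy).trans_eq ?_
    rw [hσ]; ring
  · rw [← hσ, ← hL]
    intro n m
    have h1 : ((iterSumset n A' - iterSumset m A').card : ℝ) ≤
        (iterSumset n P - iterSumset m P).card := by
      exact_mod_cast card_iterSumset_sub_le_of_translate
        (fun x hx => (Finset.mem_filter.1 hx).2) n m
    -- The lower bound `l₁ ≥ 1/(7μ)` makes `P` at most about `K` times as large as `A'`.
    have h4 : (P.card : ℝ) ≤ 7 * μ * (a / ρ) * A'.card := by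
      have h5 : P.card * (1 / (7 * μ) * ρ) ≤ a * A'.card := le_trans (by gcongr) hy
      calc (P.card : ℝ) = 7 * μ / ρ * (P.card * (1 / (7 * μ) * ρ)) := by field_simp
        _ ≤ 7 * μ / ρ * (a * A'.card) := by gcongr
        _ = _ := by ring
    calc _ ≤ L ^ (n + m) * P.card := h1.trans (card_iterSumset_sub_le hPne hdoubling n m)
      _ ≤ L ^ (n + m) * (7 * μ * (a / ρ) * A'.card) := by gcongr
      _ = _ := by ring

/-- Choice of the truncation height `T` and of the number of levels `J`. -/
theorem exists_truncation_parameters {ν ε : ℝ} (hν : 1 ≤ ν) (hε : 0 < ε) (hε1 : ε ≤ 1) :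
    ∃ (T : ℝ) (J : ℕ), 0 < T ∧ T ^ 2 = 48 ^ (1 / ε) * (ν ^ 6) ^ (3 / ε + 2) ∧
      (J : ℝ) ≤ 82 ^ (1 / ε) ∧ 48 * ν ^ 6 * ((ν ^ 6) ^ (1 + ε)) ^ 2 ≤ T ^ (2 * ε) ∧
      192 * (ν ^ 6) ^ 3 * T * (7 * ν ^ 6) < (2 * ν) ^ J := by
  have hν0 : 0 < ν := by linarith
  set e := 1 / ε with he
  have he1 : 1 ≤ e := by rw [he, le_div_iff₀ hε]; linarith
  have h3e : 3 / ε = 3 * e := by rw [he]; ring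
  set X : ℝ := 48 * (ν ^ 6) ^ (3 + 2 * ε) with hX
  have hX0 : 0 < X := by positivity
  have hXe : X ^ e = 48 ^ e * (ν ^ 6) ^ (3 / ε + 2) := by
    rw [hX, Real.mul_rpow (by norm_num) (by positivity), ← Real.rpow_mul (by positivity)]
    congr 2
    rw [he]; field_simp
  have hT2 : (X ^ (e / 2)) ^ 2 = X ^ e := by
    rw [← Real.rpow_natCast, ← Real.rpow_mul hX0.le]
    congr 1
    push_cast; ring
  -- `T` gives equality in its constraint. The level range is below `2^(3e + 11) ν^(9e + 30)`, and
  -- `40e` exceeds both exponents since `e ≥ 1`. The bound `82 = 41 · 2` comes from `⌈40e⌉ ≤ 41e`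
  -- and `e ≤ 2^e`.
  refine ⟨X ^ (e / 2), ⌈40 * e⌉₊, by positivity, by rw [hT2, hXe], ?_, ?_, ?_⟩
  · have h1 : (⌈40 * e⌉₊ : ℝ) ≤ 41 * e := by
      have := (Nat.ceil_lt_add_one (by positivity : 0 ≤ 40 * e)).le
      linarith
    have h2 : 1 + e * 1 ≤ (1 + 1 : ℝ) ^ e := one_add_mul_self_le_rpow_one_add (by norm_num) he1
    have h3 : (41 : ℝ) ≤ 41 ^ e := by
      simpa using Real.rpow_le_rpow_of_exponent_le (by norm_num : (1:ℝ) ≤ 41) he1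
    calc (⌈40 * e⌉₊ : ℝ) ≤ 41 * e := h1
      _ ≤ 41 ^ e * (1 + 1) ^ e := by gcongr; linarith
      _ = 82 ^ e := by rw [← Real.mul_rpow (by norm_num) (by norm_num)]; norm_num
  · rw [← Real.rpow_mul hX0.le, show e / 2 * (2 * ε) = 1 by rw [he]; field_simp, Real.rpow_one, hX,
      Real.rpow_add (by positivity), Real.rpow_add (by positivity), Real.rpow_one, two_mul,
      Real.rpow_add (by positivity), show (ν ^ 6) ^ (3:ℝ) = (ν ^ 6) ^ 3 by norm_cast]
    apply le_of_eq
    ring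
  · have hTle : X ^ (e / 2) ≤ 8 ^ e * ν ^ (9 * e + 6) := by
      refine le_of_sq_le_sq ?_ (by positivity)
      rw [hT2, hXe, mul_pow]
      have e1 : ((8:ℝ) ^ e) ^ 2 = 64 ^ e := by
        rw [← Real.rpow_natCast, ← Real.rpow_mul (by norm_num), mul_comm, Real.rpow_mul (by norm_num)]
        norm_num
      have e2 : (ν ^ (9 * e + 6)) ^ 2 = (ν ^ 6) ^ (3 / ε + 2) := by
        rw [← Real.rpow_natCast, ← Real.rpow_mul hν0.le, ← Real.rpow_natCast ν 6,
          ← Real.rpow_mul hν0.le, h3e]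
        congr 1
        push_cast; ring
      rw [e1, e2]
      gcongr
      norm_num
    have hpow : (2 * ν) ^ (40 * e) ≤ (2 * ν) ^ ⌈40 * e⌉₊ := by
      rw [← Real.rpow_natCast (2 * ν)]
      exact Real.rpow_le_rpow_of_exponent_le (by linarith) (Nat.le_ceil _)
    refine lt_of_lt_of_le ?_ hpow
    rw [Real.mul_rpow (by norm_num) hν0.le]
    have h8 : (8:ℝ) ^ e = 2 ^ (3 * e) := by
      rw [Real.rpow_mul (by norm_num)]; norm_num
    calc 192 * (ν ^ 6) ^ 3 * X ^ (e / 2) * (7 * ν ^ 6)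
        ≤ 192 * (ν ^ 6) ^ 3 * (8 ^ e * ν ^ (9 * e + 6)) * (7 * ν ^ 6) := by gcongr
      _ = 1344 * 2 ^ (3 * e) * ν ^ (9 * e + 30) := by
        rw [h8, show 9 * e + 30 = 9 * e + 6 + (24 : ℕ) by push_cast; ring,
          Real.rpow_add hν0 _ ((24 : ℕ) : ℝ), Real.rpow_natCast]
        ring
      _ < 2 ^ 11 * 2 ^ (3 * e) * ν ^ (9 * e + 30) := by gcongr; norm_num
      _ = 2 ^ (3 * e + (11 : ℕ)) * ν ^ (9 * e + 30) := by
        rw [Real.rpow_add two_pos (3 * e), Real.rpow_natCast]; ring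
      _ ≤ 2 ^ (40 * e) * ν ^ (40 * e) := by
        gcongr
        · norm_num
        · push_cast; linarith
        · linarith

theorem theoremt :
    ∃ C : ℝ, 1 ≤ C ∧
      ∀ (G : Type*) [AddCommGroup G] [DecidableEq G] (A : Finset G) (K M ε : ℝ),
        A.Nonempty → 0 < ε → ε ≤ 1 →
        (Finset.addEnergy A A : ℝ) = (A.card : ℝ) ^ 3 / K →
        higherEnergy (3 + ε) A = M * (A.card : ℝ) ^ (4 + ε) / K ^ (2 + ε) →
        ∃ A' ⊆ A,
          C ^ (-(1 / ε)) * M ^ (-((3 + 6 * ε) / (ε * (1 + ε)))) * (A.card : ℝ) ≤ (A'.card : ℝ) ∧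
          ∀ n m : ℕ,
            ((iterSumset n A' - iterSumset m A').card : ℝ) ≤
              C ^ (((n : ℝ) + m) / ε) *
                M ^ (6 * ((n : ℝ) + m) * ((3 + 4 * ε) / (ε * (1 + ε)))) * K * (A'.card : ℝ) := by
  -- Chosen so that the doubling constant times `7μ` is `c J¹⁸ μ²⁵`; the factor `82 ^ 18` absorbs
  -- `J¹⁸`.
  obtain ⟨c, hc⟩ : ∃ c : ℝ, c = 7 * 2 ^ 24 * 3072 ^ 6 := ⟨_, rfl⟩
  have hc1 : 1 ≤ c := by rw [hc]; norm_num
  have hC0 : (0 : ℝ) < c * 82 ^ 18 := by positivity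
  refine ⟨c * 82 ^ 18, by rw [hc]; norm_num, ?_⟩
  intro G _ _ A K M ε hA hε hε1 hE hM
  obtain ⟨a, ha⟩ : ∃ a : ℝ, a = A.card := ⟨_, rfl⟩
  have ha0 : 0 < a := by rw [ha]; exact_mod_cast hA.card_pos
  rw [← ha] at hE hM ⊢
  have hE0 : (0 : ℝ) < Finset.addEnergy A A := by
    exact_mod_cast Finset.addEnergy_self_pos hA
  have hK : 0 < K := by
    rw [hE] at hE0
    exact (div_pos_iff_of_pos_left (by positivity)).1 hE0
  obtain ⟨ρ, hρdef⟩ : ∃ ρ, ρ = a / K := ⟨_, rfl⟩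
  have hρ : 0 < ρ := by rw [hρdef]; positivity
  have hKρ : a / ρ = K := by rw [hρdef]; field_simp
  have hE' : (Finset.addEnergy A A : ℝ) = a ^ 2 * ρ := by rw [hE, hρdef]; ring
  have hM' : higherEnergy (3 + ε) A = M * (a ^ 2 * ρ ^ (2 + ε)) := by
    rw [hM, hρdef, Real.div_rpow ha0.le hK.le, show 4 + ε = 2 + (2 + ε) by ring,
      Real.rpow_add ha0, show a ^ (2:ℝ) = a ^ 2 by norm_cast]
    ring
  have h1 : ∑ s ∈ A - A, (diffRep A s : ℝ) = a ^ 2 := by rw [sum_diffRep, ha]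
  have h2 : ∑ s ∈ A - A, (diffRep A s : ℝ) ^ 2 = a ^ 2 * ρ := by rw [sum_diffRep_sq, hE']
  have hM1 : 1 ≤ M := by
    refine one_le_of_moments (D := A - A) (f := fun x => (diffRep A x : ℝ)) (fun x => by positivity)
      (by positivity) hρ (by linarith : 1 ≤ 2 + ε) h1 h2 ?_
    rw [← hM', higherEnergy, show 1 + (2 + ε) = 3 + ε by ring]
  have hM0 : 0 < M := by linarith
  have hK1 : 1 ≤ K := by
    have h3 : a ^ 2 * ρ ≤ a ^ 2 * a := by
      rw [← h2, ← h1, Finset.sum_mul]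
      refine Finset.sum_le_sum fun s _ => ?_
      rw [sq, ha]
      gcongr
      exact_mod_cast Finset.card_filter_le _ _
    rw [← hKρ, one_le_div hρ]
    exact le_of_mul_le_mul_left h3 (by positivity)
  obtain ⟨ν, hν⟩ : ∃ ν, ν = M ^ (1 / (6 * (1 + ε))) := ⟨_, rfl⟩
  have hν1 : 1 ≤ ν := by rw [hν]; exact Real.one_le_rpow hM1 (by positivity)
  have hν6 : ν ^ 6 = M ^ (1 / (1 + ε)) := by
    rw [hν, ← Real.rpow_natCast, ← Real.rpow_mul hM0.le]
    congr 1
    push_cast; field_simp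
  have hMpow : ∀ x : ℝ, (ν ^ 6) ^ (x * (1 + ε)) = M ^ x := fun x => by
    rw [hν6, ← Real.rpow_mul hM0.le]
    congr 1
    field_simp
  obtain ⟨T, J, hT0, hT2, hJle, hT, hJ⟩ := exists_truncation_parameters hν1 hε hε1
  have hMM : (ν ^ 6) ^ (1 + ε) = M := by simpa using hMpow 1
  obtain ⟨A', hA's, hbig, hsum⟩ := exists_subset_small_iterSumset hA hρ hν1 hε hT0
    (by rw [hE', ha]) (by rw [hM', hMM, ha]) hT hJ
  rw [← ha] at hbig hsum
  obtain ⟨μ, hμ⟩ : ∃ μ, μ = ν ^ 6 := ⟨_, rfl⟩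
  rw [← hμ] at hbig hsum hMpow hT2
  have hμ1 : 1 ≤ μ := by rw [hμ]; exact one_le_pow₀ hν1
  have hμ0 : 0 < μ := by linarith
  have he1 : 1 ≤ 1 / ε := by rw [le_div_iff₀ hε]; linarith
  have hself : ∀ x : ℝ, 1 ≤ x → x ≤ x ^ (1 / ε) := fun x hx => by
    simpa using Real.rpow_le_rpow_of_exponent_le hx he1
  refine ⟨A', hA's, ?_, ?_⟩
  · have hexp : M ^ ((3 + 6 * ε) / (ε * (1 + ε))) = μ ^ (3 / ε + 6) := by
      rw [← hMpow]
      congr 1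
      field_simp
    have hcoef : 24576 * J ^ 3 * μ ^ 3 * T ^ 2 ≤ (c * 82 ^ 18) ^ (1 / ε) * μ ^ (3 / ε + 6) := by
      have e1 : μ ^ (3 / ε + 2) * μ ^ 3 ≤ μ ^ (3 / ε + 6) := by
        rw [← Real.rpow_natCast, ← Real.rpow_add hμ0]
        refine Real.rpow_le_rpow_of_exponent_le hμ1 ?_
        push_cast; linarith
      have e2 : ((82:ℝ) ^ (1 / ε)) ^ 3 = (82 ^ 3) ^ (1 / ε) := by
        rw [← Real.rpow_natCast, ← Real.rpow_natCast, ← Real.rpow_mul (by norm_num),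
          ← Real.rpow_mul (by norm_num), mul_comm]
      rw [hT2]
      calc 24576 * (J:ℝ) ^ 3 * μ ^ 3 * (48 ^ (1 / ε) * μ ^ (3 / ε + 2))
          = 24576 * (J:ℝ) ^ 3 * 48 ^ (1 / ε) * (μ ^ (3 / ε + 2) * μ ^ 3) := by ring
        _ ≤ 24576 ^ (1 / ε) * (82 ^ (1 / ε)) ^ 3 * 48 ^ (1 / ε) * μ ^ (3 / ε + 6) := by
          gcongr
          exact hself _ (by norm_num)
        _ = (24576 * 82 ^ 3 * 48) ^ (1 / ε) * μ ^ (3 / ε + 6) := by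
          rw [e2, Real.mul_rpow (by norm_num) (by norm_num),
            Real.mul_rpow (by norm_num) (by norm_num)]
        _ ≤ _ := by
          refine mul_le_mul_of_nonneg_right ?_ (by positivity)
          refine Real.rpow_le_rpow (by norm_num) ?_ (by positivity)
          rw [hc]; norm_num
    rw [Real.rpow_neg hC0.le, Real.rpow_neg hM0.le, hexp, ← mul_inv, ← div_eq_inv_mul,
      div_le_iff₀ (by positivity), mul_comm]
    exact hbig.trans (by gcongr)
  · intro n m
    -- For `n + m ≥ 1` the stray factor `7μ` is absorbed into the `(n + m)`-th power. For `n = m =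
    -- 0` the claim is `1 ≤ K|A'|`, which needs `K ≥ 1`.
    rcases Nat.eq_zero_or_pos (n + m) with h0 | hpos
    · obtain ⟨rfl, rfl⟩ : n = 0 ∧ m = 0 := by omega
      have hA'1 : (1 : ℝ) ≤ A'.card := by
        have : A'.card ≠ 0 := by
          intro h
          rw [h, Nat.cast_zero, mul_zero] at hbig
          linarith
        exact_mod_cast Nat.one_le_iff_ne_zero.2 this
      simp only [iterSumset, sub_self, Finset.singleton_sub_singleton, Finset.card_singleton,
        Nat.cast_one, Nat.cast_zero, add_zero, zero_div, mul_zero, zero_mul, Real.rpow_zero, one_mul]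
      nlinarith
    · have hexp : M ^ (6 * ((n:ℝ) + m) * ((3 + 4 * ε) / (ε * (1 + ε)))) =
          (μ ^ (18 / ε + 24)) ^ (n + m) := by
        rw [← Real.rpow_natCast, ← Real.rpow_mul hμ0.le, ← hMpow]
        congr 1
        push_cast
        field_simp
        ring
      have hCexp : (c * 82 ^ 18) ^ (((n : ℝ) + m) / ε) = ((c * 82 ^ 18) ^ (1 / ε)) ^ (n + m) := by
        rw [← Real.rpow_natCast ((c * 82 ^ 18) ^ (1 / ε)), ← Real.rpow_mul hC0.le]
        congr 1
        push_cast
        ring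
      set L : ℝ := 2 ^ 24 * (3072 * J ^ 3 * μ ^ 2) ^ 6 * μ ^ 12 with hL
      have hcoef : L * (7 * μ) ≤ (c * 82 ^ 18) ^ (1 / ε) * μ ^ (18 / ε + 24) := by
        have e1 : μ ^ 25 ≤ μ ^ (18 / ε + 24) := by
          rw [← Real.rpow_natCast]
          refine Real.rpow_le_rpow_of_exponent_le hμ1 ?_
          push_cast
          have : 18 / ε = 18 * (1 / ε) := by ring
          linarith
        have e2 : ((82:ℝ) ^ (1 / ε)) ^ 18 = (82 ^ 18) ^ (1 / ε) := by
          rw [← Real.rpow_natCast, ← Real.rpow_natCast, ← Real.rpow_mul (by norm_num),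
            ← Real.rpow_mul (by norm_num), mul_comm]
        calc L * (7 * μ) = c * (J:ℝ) ^ 18 * μ ^ 25 := by rw [hL, hc]; ring
          _ ≤ c ^ (1 / ε) * (82 ^ (1 / ε)) ^ 18 * μ ^ (18 / ε + 24) := by
            gcongr
            exact hself _ hc1
          _ = _ := by rw [e2, ← Real.mul_rpow (by linarith) (by norm_num)]
      rw [hexp, hCexp, ← mul_pow]
      refine (hsum n m).trans ?_
      rw [hKρ]
      gcongr
      calc L ^ (n + m) * (7 * μ) ≤ L ^ (n + m) * (7 * μ) ^ (n + m) := by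
            gcongr
            exact le_self_pow₀ (by linarith) (by omega)
        _ = (L * (7 * μ)) ^ (n + m) := (mul_pow _ _ _).symm
        _ ≤ _ := by gcongr
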